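/- Let $(\Omega,\mathcal F,\mathbb P)$ be a complete probability space, $\vartheta:\Omega\to\Omega$ a $\mathbb P$-preserving transformation, and $X$ a compact metric space with Borel $\sigma$-algebra $\mathcal B$. Let $\mathcal E\in\mathcal F\otimes\mathcal B$ be a subset of $\Omega\times X$ whose fibers $\mathcal E_\omega=\{x\in X:(\omega,x)\in\mathcal E\}$ are nonempty and compact for all $\omega\in\Omega$. Let $T$ be a continuous bundle random dynamical system on $\mathcal E$, that is, a family of maps $T_\omega:\mathcal E_\omega\to\mathcal E_{\vartheta\omega}$ $(\omega\in\Omega)$ such that $(\omega,x)\mapsto T_\omega x$ is measurable on $\mathcal E$ and $x\mapsto T_\omega x$ is continuous for $\mathbb P$-almost all $\omega$. Write $T^0_\omega=\mathrm{id}$, $T^n_\omega=T_{\vartheta^{n-1}\omega}\circ\cdots\circ T_{\vartheta\omega}\circ T_\omega$ for $n\ge 1$, and let $\Theta:\mathcal E\to\mathcal E$, $\Theta(\omega,x)=(\vartheta\omega,T_\omega x)$, be the skew product. A Borel set $E\subset X$ is called $T$-small if for $\mathbb P$-almost every $\omega$ its $\omega$-orbit capacity $$\mathrm{ocap}^\omega(E)=\lim_{n\to\infty}\frac1n\sup_{x\in\mathcal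 E_\omega}\sum_{i=0}^{n-1}1_E(T^i_\omega x)$$ exists and equals $0$. Let $\mathcal I_{\mathbb P}(\mathcal E)$ be the set of all probability measures $\mu$ on $\Omega\times X$ that have marginal $\mathbb P$ on $\Omega$, satisfy $\mu(\mathcal E)=1$, and are $\Theta$-invariant. Then for every closed set $E\subset X$, $$E\text{ is }T\text{-small}\iff \mu(\Omega\times E)=0\ \text{ for all }\mu\in\mathcal I_{\mathbb P}(\mathcal E).$$ -/

import Mathlib

open MeasureTheory Filter Topology

noncomputable section

/-- The fiber `S_ω = {x | (ω, x) ∈ S}` of a subset `S` of `Ω × X`. -/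
def bundleFiber {Ω X : Type*} (S : Set (Ω × X)) (ω : Ω) : Set X := {x | (ω, x) ∈ S}

/-- A continuous bundle random dynamical system over `(Ω, P, ϑ)` with state space `X`: a measurable
set `bundle ⊆ Ω × X` whose fibers are nonempty and compact, and maps `T_ω` from the fiber over `ω`
to the fiber over `ϑ ω`, jointly measurable in `(ω, x)` and continuous for almost all `ω`. -/
structure BundleRDS {Ω : Type*} [MeasurableSpace Ω] (P : Measure Ω) (ϑ : Ω → Ω)
    (X : Type*) [MetricSpace X] [MeasurableSpace X] where
  bundle : Set (Ω × X)
  measurableSet_bundle : MeasurableSet bundle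
  nonempty_fiber : ∀ ω, (bundleFiber bundle ω).Nonempty
  isCompact_fiber : ∀ ω, IsCompact (bundleFiber bundle ω)
  map : ∀ ω, bundleFiber bundle ω → bundleFiber bundle (ϑ ω)
  measurable_map : Measurable fun p : bundle => (map p.1.1 ⟨p.1.2, p.2⟩ : X)
  continuous_map : ∀ᵐ ω ∂P, Continuous (map ω)

namespace BundleRDS

variable {Ω : Type*} [MeasurableSpace Ω] {P : Measure Ω} {ϑ : Ω → Ω}
  {X : Type*} [MetricSpace X] [MeasurableSpace X]

/-- The iterates `T_ω^n = T_{ϑ^{n-1} ω} ∘ ⋯ ∘ T_{ϑ ω} ∘ T_ω`. -/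
def iter (T : BundleRDS P ϑ X) :
    ∀ (n : ℕ) (ω : Ω), bundleFiber T.bundle ω → bundleFiber T.bundle (ϑ^[n] ω)
  | 0, _ => fun x => x
  | n + 1, ω => fun x => T.iter n (ϑ ω) (T.map ω x)

/-- The skew product `Θ (ω, x) = (ϑ ω, T_ω x)` on the bundle. -/
def skewProduct (T : BundleRDS P ϑ X) (p : T.bundle) : T.bundle :=
  ⟨(ϑ p.1.1, (T.map p.1.1 ⟨p.1.2, p.2⟩ : X)), (T.map p.1.1 ⟨p.1.2, p.2⟩).2⟩

theorem skewProduct_iterate (T : BundleRDS P ϑ X) (n : ℕ) (p : T.bundle) :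
    ((T.skewProduct^[n] p : T.bundle) : Ω × X)
      = (ϑ^[n] p.1.1, (T.iter n p.1.1 ⟨p.1.2, p.2⟩ : X)) := by
  induction n generalizing p with
  | zero => rfl
  | succ n ih =>
    rw [Function.iterate_succ_apply, ih]
    rfl

/-- `b_n(ω) = sup_{x ∈ E_ω} ∑_{i < n} 1_E (T_ω^i x)`: the largest number of visits to `E` during
the first `n` steps of an orbit that starts in the fiber over `ω`. -/
def maxVisits (T : BundleRDS P ϑ X) (E : Set X) (n : ℕ) (ω : Ω) : ℝ :=
  ⨆ x : bundleFiber T.bundle ω,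
    ∑ i ∈ Finset.range n, E.indicator (fun _ => (1 : ℝ)) (T.iter i ω x : X)

/-- The limit `lim_n b_n(ω) / n` defining the `ω`-orbit capacity of `E` exists and equals `c`. -/
def HasOrbitCapacity (T : BundleRDS P ϑ X) (E : Set X) (ω : Ω) (c : ℝ) : Prop :=
  Tendsto (fun n : ℕ => (1 / (n : ℝ)) * T.maxVisits E n ω) atTop (𝓝 c)

/-- `E` is `T`-small if its `ω`-orbit capacity is `0` for almost every `ω`. -/
def IsSmall (T : BundleRDS P ϑ X) (E : Set X) : Prop :=
  ∀ᵐ ω ∂P, T.HasOrbitCapacity E ω 0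

/-- The probability measures on `Ω × X` with marginal `P` on `Ω` that give the bundle mass one and
whose restriction to the bundle is invariant under the skew product. -/
structure IsInvariantRandomMeasure (T : BundleRDS P ϑ X) (μ : Measure (Ω × X)) : Prop where
  isProbabilityMeasure : IsProbabilityMeasure μ
  marginal : μ.map Prod.fst = P
  bundle_eq_one : μ T.bundle = 1
  invariant : MeasurePreserving T.skewProduct
    (μ.comap (Subtype.val : T.bundle → Ω × X)) (μ.comap (Subtype.val : T.bundle → Ω × X))

end BundleRDS

end

/-!
The maximal visit counts `b_n` form a nonnegative subadditive cocycle over `ϑ`; they are measurable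
by the measurable projection theorem, as `P` is complete. By the maximal inequality, applied to the
Birkhoff sums of a single `b_k`, `b_n / n` tends to `0` almost everywhere as soon as
`(1 / k) ∫ b_k dP` becomes arbitrarily small.

Suppose instead that `∫ b_k dP ≥ ε k` for all `k`. Start orbits of length `k` at a measurable
section of points that maximize the number of visits to `E`, and average along them as in the
Krylov–Bogoliubov argument: the resulting measures give `Ω × E` mass at least `ε`, and are invariant
up to an error of order `1 / k`. Such measures form convex sets that decrease with `k`, so one can
choose elements whose disintegrations converge weakly for almost every `ω`. The limit is invariant,
because `T` is continuous on almost every fiber, and it still charges `Ω × E` with mass `ε`, because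
`E` is closed.

Conversely, for an invariant `μ` the mass `μ (Ω × E)` is for every `n` the integral of the visit
frequency along orbits of length `n`, which is at most `b_n / n`.
-/

open Set ProbabilityTheory
open scoped ENNReal NNReal BoundedContinuousFunction

section MeasurableProjection

theorem exists_forall_lt_le_subset_of_isOpen {m : ℕ → ℕ} {V : Set (ℕ → ℕ)} (hV : IsOpen V)
    (hmV : Iic m ⊆ V) : ∃ k, {y : ℕ → ℕ | ∀ i < k, y i ≤ m i} ⊆ V := by
  by_contra! hcon
  choose y hy hyV using fun k => not_subset.1 (hcon k)
  have hcompact : IsCompact (Iic m) := Icc_bot (a := m) ▸ isCompact_Icc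
  obtain ⟨z, hz, φ, hφ, hlim⟩ :=
    hcompact.tendsto_subseq (x := fun k => y k ⊓ m) fun k => mem_Iic.2 inf_le_right
  have hlim_y : Tendsto (fun k => y (φ k)) atTop (𝓝 z) := by
    rw [tendsto_pi_nhds] at hlim ⊢
    intro i
    refine (hlim i).congr' ?_
    filter_upwards [eventually_gt_atTop i] with k hk
    exact min_eq_left (hy _ i (hk.trans_le hφ.le_apply))
  exact hV.isClosed_compl.mem_of_tendsto hlim_y (Eventually.of_forall fun k => hyV _) (hmV hz)

variable {α : Type*} [MeasurableSpace α]

theorem exists_forall_lt_measure_image (μ : Measure α) (f : (ℕ → ℕ) → α) {a : ℝ≥0∞}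
    (ha : a < μ (range f)) :
    ∃ m : ℕ → ℕ, ∀ k, a < μ (f '' {y | ∀ i < k, y i ≤ m i}) := by
  have cut (S : Set (ℕ → ℕ)) (k : ℕ) (hS : a < μ (f '' S)) :
      ∃ j, a < μ (f '' (S ∩ {y | y k ≤ j})) := by
    have hmono : Monotone fun j => f '' (S ∩ {y | y k ≤ j}) := fun i j hij =>
      image_mono (inter_subset_inter_right _ fun y (hy : y k ≤ i) => hy.trans hij)
    have hunion : ⋃ j, {y : ℕ → ℕ | y k ≤ j} = univ :=
      iUnion_eq_univ_iff.2 fun y => ⟨y k, le_refl (y k)⟩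
    rw [← inter_univ S, ← hunion, inter_iUnion, image_iUnion, hmono.measure_iUnion] at hS
    exact lt_iSup_iff.1 hS
  choose! bound hbound using cut
  let S : ℕ → Set (ℕ → ℕ) := fun k => Nat.rec univ (fun k S => S ∩ {y | y k ≤ bound S k}) k
  have hS (k : ℕ) : a < μ (f '' S k) := by
    induction k with
    | zero => simpa [S] using ha
    | succ k ih => exact hbound _ k ih
  refine ⟨fun k => bound (S k) k, fun k => (hS k).trans_le (measure_mono (image_mono ?_))⟩
  induction k with
  | zero => exact fun y _ i hi => absurd hi i.not_lt_zero
  | succ k ih =>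
    rintro y ⟨hy, hyk⟩ i hi
    rcases Nat.lt_succ_iff_lt_or_eq.1 hi with hi | rfl
    exacts [ih hy i hi, hyk]

theorem nullMeasurableSet_of_forall_lt_exists_subset {μ : Measure α} {s : Set α} (hs : μ s ≠ ∞)
    (h : ∀ a < μ s, ∃ K ⊆ s, MeasurableSet K ∧ a ≤ μ K) : NullMeasurableSet s μ := by
  rcases eq_or_ne (μ s) 0 with h0 | h0
  · exact NullMeasurableSet.of_null h0
  obtain ⟨u, -, hu, hlim⟩ := exists_seq_strictMono_tendsto' (pos_iff_ne_zero.2 h0)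
  choose K hKs hK huK using fun n => h (u n) (hu n).2
  have hmeas : NullMeasurableSet (⋃ n, K n) μ := (MeasurableSet.iUnion hK).nullMeasurableSet
  have hle : μ s ≤ μ (⋃ n, K n) :=
    le_of_tendsto' hlim fun n => (huK n).trans (measure_mono (subset_iUnion K n))
  exact hmeas.congr (ae_eq_of_subset_of_measure_ge (iUnion_subset hKs) hle hmeas hs)

variable [TopologicalSpace α]

theorem exists_isCompact_subset_range_of_lt (μ : Measure α) [μ.OuterRegular] {f : (ℕ → ℕ) → α}
    (hf : Continuous f) {a : ℝ≥0∞} (ha : a < μ (range f)) :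
    ∃ K ⊆ range f, IsCompact K ∧ a ≤ μ K := by
  obtain ⟨m, hm⟩ := exists_forall_lt_measure_image μ f ha
  have hcompact : IsCompact (Iic m) := Icc_bot (a := m) ▸ isCompact_Icc
  refine ⟨f '' Iic m, image_subset_range _ _, hcompact.image hf, ?_⟩
  rw [measure_eq_iInf_isOpen]
  refine le_iInf₂ fun U hU => le_iInf fun hUo => ?_
  obtain ⟨k, hk⟩ := exists_forall_lt_le_subset_of_isOpen (hUo.preimage hf) (image_subset_iff.1 hU)
  exact (hm k).le.trans (measure_mono (image_subset_iff.2 hk))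

theorem nullMeasurableSet_of_analyticSet [PolishSpace α] [BorelSpace α] {s : Set α}
    (hs : AnalyticSet s) (μ : Measure α) [IsFiniteMeasure μ] : NullMeasurableSet s μ := by
  let := TopologicalSpace.upgradeIsCompletelyMetrizable α
  rw [AnalyticSet] at hs
  obtain rfl | ⟨f, hf, rfl⟩ := hs
  · exact nullMeasurableSet_empty
  refine nullMeasurableSet_of_forall_lt_exists_subset (measure_ne_top _ _) fun a ha => ?_
  obtain ⟨K, hKs, hK, haK⟩ := exists_isCompact_subset_range_of_lt μ hf ha
  exact ⟨K, hKs, hK.measurableSet, haK⟩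

variable {Ω X : Type*} [MeasurableSpace Ω] [MeasurableSpace X]

theorem exists_measurable_natBool_eq_preimage {D : Set (Ω × X)} (hD : MeasurableSet D) :
    ∃ π : Ω → ℕ → Bool, Measurable π ∧ ∃ D' : Set ((ℕ → Bool) × X), MeasurableSet D' ∧
      D = Prod.map π id ⁻¹' D' := by
  classical
  rw [← generateFrom_prod] at hD
  induction D, hD using MeasurableSpace.generateFrom_induction with
  | hC t ht _ =>
    obtain ⟨A, hA, B, hB, rfl⟩ := ht
    have hdecide : Measurable fun ω => decide (ω ∈ A) := measurable_to_bool <| by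
      convert (show MeasurableSet A from hA) using 1
      ext; simp
    refine ⟨fun ω _ => decide (ω ∈ A), measurable_pi_lambda _ fun _ => hdecide,
      {y | y 0 = true} ×ˢ B, MeasurableSet.prod ?_ hB, by ext; simp⟩
    exact measurable_pi_apply (X := fun _ => Bool) 0 (measurableSet_singleton true)
  | empty => exact ⟨fun _ _ => true, measurable_const, ∅, MeasurableSet.empty, rfl⟩
  | compl t _ ih =>
    obtain ⟨π, hπ, D', hD', rfl⟩ := ih
    exact ⟨π, hπ, D'ᶜ, hD'.compl, rfl⟩
  | iUnion s _ ih =>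
    choose π hπ D' hD' hs using ih
    have hproj (n : ℕ) : Measurable fun y : ℕ → Bool => fun j => y (Nat.pair n j) :=
      measurable_pi_lambda _ fun j => measurable_pi_apply _
    refine ⟨fun ω k => π k.unpair.1 ω k.unpair.2,
      measurable_pi_lambda _ fun k => (measurable_pi_apply _).comp (hπ _),
      ⋃ n, Prod.map (fun y j => y (Nat.pair n j)) id ⁻¹' D' n,
      MeasurableSet.iUnion fun n => (hproj n).prodMap measurable_id (hD' n), ?_⟩
    ext p
    simp only [hs, preimage_iUnion, mem_iUnion, mem_preimage, Prod.map, Nat.unpair_pair]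
    rfl

theorem measurableSet_image_fst [StandardBorelSpace X] (P : Measure Ω) [IsFiniteMeasure P]
    [P.IsComplete] {D : Set (Ω × X)} (hD : MeasurableSet D) : MeasurableSet (Prod.fst '' D) := by
  let := upgradeStandardBorel X
  let := TopologicalSpace.metrizableSpaceMetric (ℕ → Bool)
  have : PolishSpace (ℕ → Bool) := inferInstance
  obtain ⟨π, hπ, D', hD', rfl⟩ := exists_measurable_natBool_eq_preimage hD
  have himage : Prod.fst '' (Prod.map π id ⁻¹' D') = π ⁻¹' (Prod.fst '' D') := by ext; simp
  have hanalytic : AnalyticSet (Prod.fst '' D') := hD'.analyticSet_image measurable_fst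
  rw [himage]
  exact ((nullMeasurableSet_of_analyticSet hanalytic (P.map π)).preimage
    (hπ.quasiMeasurePreserving P)).measurable_of_complete

end MeasurableProjection

section MeasurableSelection

variable {Ω X : Type*} [MeasurableSpace Ω]

/-- A random compact set, encoded by its graph: a measurable subset of `Ω × X` all of whose fibers
are nonempty and compact. -/
structure IsRandomCompactSet [TopologicalSpace X] [MeasurableSpace X] (S : Set (Ω × X)) :
    Prop where
  measurableSet : MeasurableSet S
  nonempty_fiber : ∀ ω, (bundleFiber S ω).Nonempty
  isCompact_fiber : ∀ ω, IsCompact (bundleFiber S ω)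

/-- The points of `S` at which `g` attains its supremum over their fiber; maximizing successively
countably many functions cuts a random compact set down to the graph of a measurable section. -/
def fiberArgmax {Ω X : Type*} (S : Set (Ω × X)) (g : Ω × X → ℝ) : Set (Ω × X) :=
  {p | p ∈ S ∧ g p = ⨆ x : bundleFiber S p.1, g (p.1, x)}

theorem measurable_ciSup_fiber (P : Measure Ω) [IsFiniteMeasure P] [P.IsComplete]
    [MeasurableSpace X] [StandardBorelSpace X] {S : Set (Ω × X)} (hS : MeasurableSet S)
    (hne : ∀ ω, (bundleFiber S ω).Nonempty) {g : Ω × X → ℝ} (hg : Measurable g)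
    (hbdd : ∀ ω, BddAbove (range fun x : bundleFiber S ω => g (ω, x))) :
    Measurable fun ω => ⨆ x : bundleFiber S ω, g (ω, x) := by
  refine measurable_of_Ioi fun a => ?_
  have hpreimage : (fun ω => ⨆ x : bundleFiber S ω, g (ω, x)) ⁻¹' Ioi a
      = Prod.fst '' (S ∩ g ⁻¹' Ioi a) := by
    ext ω
    have := (hne ω).to_subtype
    rw [mem_preimage, mem_Ioi, lt_ciSup_iff (hbdd ω)]
    constructor
    · rintro ⟨x, hx⟩
      exact ⟨(ω, x), ⟨x.2, hx⟩, rfl⟩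
    · rintro ⟨⟨ω', x⟩, ⟨hxS, hax⟩, rfl⟩
      exact ⟨⟨x, hxS⟩, hax⟩
  rw [hpreimage]
  exact measurableSet_image_fst P (hS.inter (hg measurableSet_Ioi))

namespace IsRandomCompactSet

theorem bddAbove_range_fiber [TopologicalSpace X] [MeasurableSpace X] {S : Set (Ω × X)}
    (hS : IsRandomCompactSet S) {g : Ω × X → ℝ} {ω : Ω}
    (husc : UpperSemicontinuousOn (fun x => g (ω, x)) (bundleFiber S ω)) :
    BddAbove (range fun x : bundleFiber S ω => g (ω, x)) := by
  have hbdd := husc.bddAbove_of_isCompact (hS.isCompact_fiber ω)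
  rwa [image_eq_range] at hbdd

theorem fiberArgmax (P : Measure Ω) [IsFiniteMeasure P] [P.IsComplete]
    [TopologicalSpace X] [MeasurableSpace X] [StandardBorelSpace X] {S : Set (Ω × X)}
    (hS : IsRandomCompactSet S) {g : Ω × X → ℝ} (hg : Measurable g)
    (husc : ∀ ω, UpperSemicontinuousOn (fun x => g (ω, x)) (bundleFiber S ω)) :
    IsRandomCompactSet (fiberArgmax S g) where
  measurableSet := hS.measurableSet.inter <| measurableSet_eq_fun hg <|
    (measurable_ciSup_fiber P hS.measurableSet hS.nonempty_fiber hg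
      fun ω => hS.bddAbove_range_fiber (husc ω)).comp measurable_fst
  nonempty_fiber ω := by
    have := (hS.nonempty_fiber ω).to_subtype
    obtain ⟨x, hx, hmax⟩ := (husc ω).exists_isMaxOn (hS.nonempty_fiber ω) (hS.isCompact_fiber ω)
    exact ⟨x, hx, le_antisymm (le_ciSup (hS.bddAbove_range_fiber (husc ω)) ⟨x, hx⟩)
      (ciSup_le fun y => hmax y.2)⟩
  isCompact_fiber ω := by
    convert (husc ω).isCompact_inter_preimage_Ici (hS.isCompact_fiber ω)
      (⨆ x : bundleFiber S ω, g (ω, x)) using 1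
    ext x
    exact and_congr_right fun hx =>
      ⟨Eq.ge, le_antisymm (le_ciSup (hS.bddAbove_range_fiber (husc ω)) ⟨x, hx⟩)⟩

variable [MetricSpace X] [PolishSpace X] [MeasurableSpace X] [BorelSpace X] {S : Set (Ω × X)}

theorem exists_measurable_section (P : Measure Ω) [IsFiniteMeasure P] [P.IsComplete]
    (hS : IsRandomCompactSet S) :
    ∃ s : Ω → X, Measurable s ∧ ∀ ω, (ω, s ω) ∈ S := by
  rcases isEmpty_or_nonempty Ω with _ | ⟨⟨ω₀⟩⟩
  · exact ⟨isEmptyElim, measurable_of_empty _, isEmptyElim⟩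
  have : Nonempty X := (hS.nonempty_fiber ω₀).nonempty
  let u := TopologicalSpace.denseSeq X
  let D : ℕ → Set (Ω × X) := fun k =>
    Nat.rec S (fun k D => _root_.fiberArgmax D fun p => dist p.2 (u k)) k
  have hD (k : ℕ) : IsRandomCompactSet (D k) := by
    induction k with
    | zero => exact hS
    | succ k ih =>
      exact ih.fiberArgmax P (by fun_prop) fun ω =>
        (continuous_id.dist continuous_const).upperSemicontinuous.upperSemicontinuousOn _
  have hinter (ω : Ω) : (⋂ k, bundleFiber (D k) ω).Nonempty :=
    IsCompact.nonempty_iInter_of_sequence_nonempty_isCompact_isClosed _ (fun k x hx => hx.1)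
      (fun k => (hD k).nonempty_fiber ω) (hS.isCompact_fiber ω)
      fun k => ((hD k).isCompact_fiber ω).isClosed
  choose s hs using hinter
  have hsD (ω : Ω) (k : ℕ) : (ω, s ω) ∈ D k := mem_iInter.1 (hs ω) k
  -- All points of the intersection have the same distances to the dense sequence `u`.
  have hunique (ω : Ω) (x : X) (hx : ∀ k, (ω, x) ∈ D k) : x = s ω := by
    have hdist (k : ℕ) : dist x (u k) = dist (s ω) (u k) :=
      (hx (k + 1)).2.trans (hsD ω (k + 1)).2.symm
    have hdist_eq : dist x = dist (s ω) :=
      (TopologicalSpace.denseRange_denseSeq X).equalizer (by fun_prop) (by fun_prop)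
        (funext hdist)
    rw [← dist_eq_zero, hdist_eq, dist_self]
  refine ⟨s, fun B hB => ?_, fun ω => hsD ω 0⟩
  have hpreimage : s ⁻¹' B = Prod.fst '' ((⋂ k, D k) ∩ Prod.snd ⁻¹' B) := by
    ext ω
    constructor
    · exact fun h => ⟨(ω, s ω), ⟨mem_iInter.2 (hsD ω), h⟩, rfl⟩
    · rintro ⟨⟨ω', x⟩, ⟨hx, hxB⟩, rfl⟩
      rwa [mem_preimage, ← hunique ω' x (mem_iInter.1 hx)]
  rw [hpreimage]
  exact measurableSet_image_fst P
    ((MeasurableSet.iInter fun k => (hD k).measurableSet).inter (measurable_snd hB))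

theorem exists_measurable_section_eq_iSup (P : Measure Ω) [IsFiniteMeasure P] [P.IsComplete]
    (hS : IsRandomCompactSet S) {g : Ω × X → ℝ} (hg : Measurable g)
    (husc : ∀ᵐ ω ∂P, UpperSemicontinuousOn (fun x => g (ω, x)) (bundleFiber S ω)) :
    ∃ s : Ω → X, Measurable s ∧ (∀ ω, (ω, s ω) ∈ S) ∧
      ∀ᵐ ω ∂P, g (ω, s ω) = ⨆ x : bundleFiber S ω, g (ω, x) := by
  let G : Set Ω := {ω | UpperSemicontinuousOn (fun x => g (ω, x)) (bundleFiber S ω)}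
  have hG : MeasurableSet G := (NullMeasurableSet.of_compl
    (NullMeasurableSet.of_null (ae_iff.1 husc))).measurable_of_complete
  let g' : Ω × X → ℝ := (Prod.fst ⁻¹' G).indicator g
  have hg' {ω : Ω} (hω : ω ∈ G) (x : X) : g' (ω, x) = g (ω, x) :=
    indicator_of_mem (s := Prod.fst ⁻¹' G) hω g
  have husc' (ω : Ω) : UpperSemicontinuousOn (fun x => g' (ω, x)) (bundleFiber S ω) := by
    by_cases hω : ω ∈ G
    · simpa only [hg' hω] using show UpperSemicontinuousOn (fun x => g (ω, x)) _ from hω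
    · have hzero (x : X) : g' (ω, x) = 0 := indicator_of_notMem (s := Prod.fst ⁻¹' G) hω g
      simpa only [hzero] using continuous_const.upperSemicontinuous.upperSemicontinuousOn _
  obtain ⟨s, hs, hsS⟩ := (hS.fiberArgmax P (hg.indicator (measurable_fst hG))
    husc').exists_measurable_section P
  refine ⟨s, hs, fun ω => (hsS ω).1, ?_⟩
  filter_upwards [husc] with ω hω
  simpa only [hg' hω] using show g' (ω, s ω) = ⨆ x : bundleFiber S ω, g' (ω, x) from (hsS ω).2

end IsRandomCompactSet

end MeasurableSelection

section MaximalInequality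

variable {Ω : Type*} {ϑ : Ω → Ω}

/-- The running maximum `max_{n ≤ N} ∑_{i < n} g ∘ ϑ^i` of Birkhoff sums, defined by recursion on
`N`. -/
def birkhoffMaximum (ϑ : Ω → Ω) (g : Ω → ℝ) : ℕ → Ω → ℝ
  | 0, _ => 0
  | N + 1, ω => max 0 (g ω + birkhoffMaximum ϑ g N (ϑ ω))

theorem birkhoffMaximum_nonneg (g : Ω → ℝ) (N : ℕ) (ω : Ω) : 0 ≤ birkhoffMaximum ϑ g N ω := by
  cases N with
  | zero => exact le_rfl
  | succ N => exact le_max_left _ _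

theorem birkhoffMaximum_le_succ (g : Ω → ℝ) (N : ℕ) (ω : Ω) :
    birkhoffMaximum ϑ g N ω ≤ birkhoffMaximum ϑ g (N + 1) ω := by
  induction N generalizing ω with
  | zero => exact birkhoffMaximum_nonneg g 1 ω
  | succ N ih => exact max_le_max le_rfl (add_le_add_right (ih (ϑ ω)) (g ω))

theorem birkhoffSum_le_birkhoffMaximum (g : Ω → ℝ) (N : ℕ) (ω : Ω) :
    birkhoffSum ϑ g N ω ≤ birkhoffMaximum ϑ g N ω := by
  induction N generalizing ω with
  | zero => exact (birkhoffSum_zero ϑ g ω).le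
  | succ N ih =>
    rw [birkhoffSum_succ']
    exact (add_le_add_right (ih (ϑ ω)) (g ω)).trans (le_max_right _ _)

theorem birkhoffMaximum_sub_comp_le (g : Ω → ℝ) (N : ℕ) (ω : Ω) :
    birkhoffMaximum ϑ g N ω - birkhoffMaximum ϑ g N (ϑ ω)
      ≤ {ω | 0 < birkhoffMaximum ϑ g N ω}.indicator g ω := by
  by_cases hpos : 0 < birkhoffMaximum ϑ g N ω
  · rw [indicator_of_mem (show ω ∈ {ω | 0 < birkhoffMaximum ϑ g N ω} from hpos)]
    cases N with
    | zero => exact absurd hpos (lt_irrefl _)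
    | succ N =>
      have hmax : birkhoffMaximum ϑ g (N + 1) ω = g ω + birkhoffMaximum ϑ g N (ϑ ω) :=
        max_eq_right (not_le.1 fun hle => hpos.ne' (max_eq_left hle)).le
      have hsucc := birkhoffMaximum_le_succ (ϑ := ϑ) g N (ϑ ω)
      linarith
  · rw [indicator_of_notMem (show ω ∉ {ω | 0 < birkhoffMaximum ϑ g N ω} from hpos)]
    have hnonneg := birkhoffMaximum_nonneg (ϑ := ϑ) g N (ϑ ω)
    linarith

variable [MeasurableSpace Ω] {P : Measure Ω}

theorem integral_comp_of_measurePreserving (hϑ : MeasurePreserving ϑ P P) {g : Ω → ℝ}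
    (hg : AEStronglyMeasurable g P) : ∫ ω, g (ϑ ω) ∂P = ∫ ω, g ω ∂P := by
  conv_rhs => rw [← hϑ.map_eq]
  exact (integral_map hϑ.aemeasurable (hϑ.map_eq.symm ▸ hg)).symm

theorem integrable_birkhoffMaximum (hϑ : MeasurePreserving ϑ P P) {g : Ω → ℝ}
    (hg : Integrable g P) (N : ℕ) : Integrable (birkhoffMaximum ϑ g N) P := by
  induction N with
  | zero => exact integrable_zero _ _ _
  | succ N ih =>
    exact (integrable_zero _ _ _).sup (hg.add (hϑ.integrable_comp_of_integrable ih))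

theorem nullMeasurableSet_birkhoffMaximum_pos (hϑ : MeasurePreserving ϑ P P) {g : Ω → ℝ}
    (hg : Integrable g P) (N : ℕ) : NullMeasurableSet {ω | 0 < birkhoffMaximum ϑ g N ω} P :=
  nullMeasurableSet_lt aemeasurable_const (integrable_birkhoffMaximum hϑ hg N).aemeasurable

theorem setIntegral_birkhoffMaximum_pos_nonneg (hϑ : MeasurePreserving ϑ P P) {g : Ω → ℝ}
    (hg : Integrable g P) (N : ℕ) : 0 ≤ ∫ ω in {ω | 0 < birkhoffMaximum ϑ g N ω}, g ω ∂P := by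
  have hpos := nullMeasurableSet_birkhoffMaximum_pos hϑ hg N
  have hM := integrable_birkhoffMaximum hϑ hg N
  have hMϑ : Integrable (fun ω => birkhoffMaximum ϑ g N (ϑ ω)) P :=
    hϑ.integrable_comp_of_integrable hM
  rw [← integral_indicator₀ hpos]
  calc (0 : ℝ) = ∫ ω, (birkhoffMaximum ϑ g N ω - birkhoffMaximum ϑ g N (ϑ ω)) ∂P := by
        rw [integral_sub hM hMϑ, integral_comp_of_measurePreserving hϑ hM.aestronglyMeasurable,
          sub_self]
    _ ≤ _ := integral_mono (hM.sub hMϑ) (hg.indicator₀ hpos) (birkhoffMaximum_sub_comp_le g N)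

theorem measure_exists_birkhoffSum_gt_le [IsFiniteMeasure P] (hϑ : MeasurePreserving ϑ P P)
    {f : Ω → ℝ} (hf : Integrable f P) (hf0 : 0 ≤ᵐ[P] f) {c : ℝ} (hc : 0 < c) :
    P {ω | ∃ n : ℕ, c * n < birkhoffSum ϑ f n ω} ≤ ENNReal.ofReal ((∫ ω, f ω ∂P) / c) := by
  let g : Ω → ℝ := fun ω => f ω - c
  have hg : Integrable g P := hf.sub (integrable_const c)
  have hsum (n : ℕ) (ω : Ω) : birkhoffSum ϑ g n ω = birkhoffSum ϑ f n ω - c * n := by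
    simp only [birkhoffSum, g, Finset.sum_sub_distrib, Finset.sum_const, Finset.card_range,
      nsmul_eq_mul, mul_comm]
  have hsub : {ω | ∃ n : ℕ, c * n < birkhoffSum ϑ f n ω}
      ⊆ ⋃ N, {ω | 0 < birkhoffMaximum ϑ g N ω} := by
    rintro ω ⟨n, hn⟩
    have hmax := birkhoffSum_le_birkhoffMaximum (ϑ := ϑ) g n ω
    exact mem_iUnion.2 ⟨n, (sub_pos.2 hn).trans_le (hsum n ω ▸ hmax)⟩
  have hmono : Monotone fun N => {ω | 0 < birkhoffMaximum ϑ g N ω} :=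
    monotone_nat_of_le_succ fun N ω hω => lt_of_lt_of_le hω (birkhoffMaximum_le_succ g N ω)
  refine (measure_mono hsub).trans ?_
  rw [hmono.measure_iUnion]
  refine iSup_le fun N => ?_
  have hnonneg := setIntegral_birkhoffMaximum_pos_nonneg hϑ hg N
  rw [integral_sub hf.integrableOn (integrable_const c), setIntegral_const, smul_eq_mul] at hnonneg
  have hle : ∫ ω in {ω | 0 < birkhoffMaximum ϑ g N ω}, f ω ∂P ≤ ∫ ω, f ω ∂P :=
    setIntegral_le_integral hf hf0
  rw [← ofReal_measureReal]
  refine ENNReal.ofReal_le_ofReal ?_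
  rw [le_div_iff₀ hc]
  linarith

end MaximalInequality

section SubadditiveCocycle

variable {Ω : Type*} {ϑ : Ω → Ω} {b : ℕ → Ω → ℝ} {C c : ℝ} {ω : Ω}

/-- `b` is a subadditive cocycle over `ϑ`, as in Kingman's theorem. -/
def IsSubadditiveCocycle (ϑ : Ω → Ω) (b : ℕ → Ω → ℝ) : Prop :=
  ∀ m n ω, b (m + n) ω ≤ b m ω + b n (ϑ^[m] ω)

namespace IsSubadditiveCocycle

theorem sum_offsets_le (hb : IsSubadditiveCocycle ϑ b) (hC : 0 ≤ C) (hbC : ∀ n ω, b n ω ≤ C * n)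
    (k m : ℕ) (ω : Ω) :
    ∑ r ∈ Finset.range k, b (k + m - r) (ϑ^[r] ω) ≤ birkhoffSum ϑ (b k) m ω + k * (C * k) := by
  induction m generalizing ω with
  | zero =>
    rw [birkhoffSum_zero, zero_add]
    calc ∑ r ∈ Finset.range k, b (k + 0 - r) (ϑ^[r] ω) ≤ ∑ _r ∈ Finset.range k, C * k :=
          Finset.sum_le_sum fun _ _ => (hbC _ _).trans (by gcongr; omega)
      _ = k * (C * k) := by simp only [Finset.sum_const, Finset.card_range, nsmul_eq_mul]
  | succ m ih =>
    have hϑω := ih (ϑ ω)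
    have hfirst : b (k + (m + 1)) ω ≤ b k ω + b (m + 1) (ϑ^[k] ω) := hb k (m + 1) ω
    have hshift : ∑ r ∈ Finset.range k, b (k + (m + 1) - r) (ϑ^[r] ω)
        + b (k + (m + 1) - k) (ϑ^[k] ω)
        = ∑ r ∈ Finset.range k, b (k + m - r) (ϑ^[r] (ϑ ω)) + b (k + (m + 1)) ω := by
      rw [← Finset.sum_range_succ (fun r => b (k + (m + 1) - r) (ϑ^[r] ω)), Finset.sum_range_succ']
      simp only [Function.iterate_succ_apply, Function.iterate_zero, id_eq, Nat.sub_zero,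
        ← Nat.add_assoc, Nat.add_sub_add_right]
    rw [birkhoffSum_succ']
    rw [Nat.add_sub_cancel_left] at hshift
    linarith

theorem mul_le_birkhoffSum_add (hb : IsSubadditiveCocycle ϑ b) (hC : 0 ≤ C)
    (hbC : ∀ n ω, b n ω ≤ C * n) (k m : ℕ) (ω : Ω) :
    k * b (k + m) ω ≤ birkhoffSum ϑ (b k) m ω + 2 * (k * (C * k)) := by
  have hsum : ∑ _r ∈ Finset.range k, b (k + m) ω
      ≤ ∑ r ∈ Finset.range k, (C * k + b (k + m - r) (ϑ^[r] ω)) := by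
    refine Finset.sum_le_sum fun r hr => ?_
    have hrk : r ≤ k := (Finset.mem_range.1 hr).le
    have hsplit := hb r (k + m - r) ω
    rw [show r + (k + m - r) = k + m by omega] at hsplit
    exact hsplit.trans (add_le_add_left ((hbC r ω).trans (by gcongr)) _)
  rw [Finset.sum_add_distrib] at hsum
  simp only [Finset.sum_const, Finset.card_range, nsmul_eq_mul] at hsum
  linarith [hb.sum_offsets_le hC hbC k m ω]

theorem exists_mul_lt_birkhoffSum (hb : IsSubadditiveCocycle ϑ b) (hC : 0 ≤ C)
    (hbC : ∀ n ω, b n ω ≤ C * n) (hc : 0 < c) (hfreq : ∃ᶠ n : ℕ in atTop, c * n < b n ω) {k : ℕ}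
    (hk : 0 < k) : ∃ m : ℕ, k * (c / 2) * m < birkhoffSum ϑ (b k) m ω := by
  obtain ⟨N, hN⟩ := exists_nat_gt (4 * (C * k) / c)
  obtain ⟨n, hn, hcn⟩ := frequently_atTop.1 hfreq (N + k)
  obtain ⟨m, rfl⟩ := Nat.exists_eq_add_of_le (show k ≤ n by omega)
  have hm : 4 * (C * k) < c * m := by
    rw [div_lt_iff₀' hc] at hN
    exact hN.trans_le (by gcongr; omega)
  have hk' : (0 : ℝ) < k := Nat.cast_pos.2 hk
  have hlower : (k : ℝ) * (c * (k + m)) < k * b (k + m) ω :=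
    mul_lt_mul_of_pos_left (mod_cast hcn) hk'
  have hsmall : (k : ℝ) * (4 * (C * k)) < k * (c * m) := mul_lt_mul_of_pos_left hm hk'
  have hpos : 0 < (k : ℝ) * (c * k) := by positivity
  refine ⟨m, ?_⟩
  linarith [hb.mul_le_birkhoffSum_add hC hbC k m ω]

variable [MeasurableSpace Ω] {P : Measure Ω} [IsFiniteMeasure P]

theorem ae_eventually_le_mul (hb : IsSubadditiveCocycle ϑ b) (hϑ : MeasurePreserving ϑ P P)
    (hb_meas : ∀ n, AEStronglyMeasurable (b n) P) (hb_nonneg : ∀ n ω, 0 ≤ b n ω) (hC : 0 ≤ C)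
    (hbC : ∀ n ω, b n ω ≤ C * n) (hinf : ∀ ε > 0, ∃ k : ℕ, 0 < k ∧ ∫ ω, b k ω ∂P < ε * k)
    (hc : 0 < c) : ∀ᵐ ω ∂P, ∀ᶠ n : ℕ in atTop, b n ω ≤ c * n := by
  have hint (n : ℕ) : Integrable (b n) P := .of_bound (hb_meas n) (C * n) <|
    Eventually.of_forall fun ω => (Real.norm_of_nonneg (hb_nonneg n ω)).trans_le (hbC n ω)
  refine ae_iff.2 (nonpos_iff_eq_zero.1 (ENNReal.le_of_forall_pos_le_add fun δ hδ _ => ?_))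
  obtain ⟨k, hk, hkδ⟩ := hinf (δ * (c / 2)) (by positivity)
  have : (0 : ℝ) < k := Nat.cast_pos.2 hk
  have hsub : {ω | ¬∀ᶠ n : ℕ in atTop, b n ω ≤ c * n}
      ⊆ {ω | ∃ m : ℕ, k * (c / 2) * m < birkhoffSum ϑ (b k) m ω} := by
    intro ω hω
    have hfreq : ∃ᶠ n : ℕ in atTop, c * n < b n ω := by
      simpa only [Filter.Frequently, not_lt, mem_ofPred_eq] using hω
    exact hb.exists_mul_lt_birkhoffSum hC hbC hc hfreq hk
  calc P {ω | ¬∀ᶠ n : ℕ in atTop, b n ω ≤ c * n}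
      ≤ ENNReal.ofReal ((∫ ω, b k ω ∂P) / (k * (c / 2))) := (measure_mono hsub).trans <|
        measure_exists_birkhoffSum_gt_le hϑ (hint k) (ae_of_all _ (hb_nonneg k)) (by positivity)
    _ ≤ ENNReal.ofReal δ := by
        refine ENNReal.ofReal_le_ofReal ((div_le_iff₀ (by positivity)).2 ?_)
        linarith
    _ = 0 + δ := by rw [ENNReal.ofReal_coe_nnreal, zero_add]

theorem ae_tendsto_zero (hb : IsSubadditiveCocycle ϑ b) (hϑ : MeasurePreserving ϑ P P)
    (hb_meas : ∀ n, AEStronglyMeasurable (b n) P) (hb_nonneg : ∀ n ω, 0 ≤ b n ω) (hC : 0 ≤ C)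
    (hbC : ∀ n ω, b n ω ≤ C * n) (hinf : ∀ ε > 0, ∃ k : ℕ, 0 < k ∧ ∫ ω, b k ω ∂P < ε * k) :
    ∀ᵐ ω ∂P, Tendsto (fun n : ℕ => 1 / (n : ℝ) * b n ω) atTop (𝓝 0) := by
  have hall : ∀ᵐ ω ∂P, ∀ j : ℕ, ∀ᶠ n : ℕ in atTop, b n ω ≤ 1 / ((j : ℝ) + 1) * n :=
    ae_all_iff.2 fun j => hb.ae_eventually_le_mul hϑ hb_meas hb_nonneg hC hbC hinf (by positivity)
  filter_upwards [hall] with ω hω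
  refine tendsto_order.2 ⟨fun a ha => Eventually.of_forall fun n =>
    ha.trans_le (mul_nonneg (by positivity) (hb_nonneg n ω)), fun ε hε => ?_⟩
  obtain ⟨j, hj⟩ := exists_nat_one_div_lt hε
  filter_upwards [hω j, eventually_gt_atTop 0] with n hn hn0
  rw [one_div_mul_eq_div, div_lt_iff₀ (Nat.cast_pos.2 hn0)]
  exact hn.trans_lt (by gcongr)

end IsSubadditiveCocycle

end SubadditiveCocycle

section ConvexCombinations

variable {V : Type*} [SeminormedAddCommGroup V] [InnerProductSpace ℝ V]

theorem cauchySeq_of_tendsto_norm_of_le_norm_add {v : ℕ → V} {d : ℕ → ℝ} {L : ℝ}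
    (hv : Tendsto (fun n => ‖v n‖) atTop (𝓝 L)) (hd : Tendsto d atTop (𝓝 L))
    (hd_nonneg : ∀ N, 0 ≤ d N) (hadd : ∀ N, ∀ m ≥ N, ∀ n ≥ N, 2 * d N ≤ ‖v m + v n‖) :
    CauchySeq v := by
  refine Metric.cauchySeq_iff.2 fun ε hε => ?_
  have hε' : 0 < ε ^ 2 / 8 := by positivity
  have hv_lt : ∀ᶠ n in atTop, ‖v n‖ ^ 2 < L ^ 2 + ε ^ 2 / 8 :=
    (hv.pow 2).eventually_lt_const (by linarith)
  have hd_gt : ∀ᶠ n in atTop, L ^ 2 - ε ^ 2 / 8 < d n ^ 2 :=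
    (hd.pow 2).eventually_const_lt (by linarith)
  obtain ⟨N, hN⟩ := eventually_atTop.1 (hv_lt.and hd_gt)
  refine ⟨N, fun m hm n hn => ?_⟩
  have hparallelogram := parallelogram_law_with_norm ℝ (v m) (v n)
  have hsum := pow_le_pow_left₀ (mul_nonneg zero_le_two (hd_nonneg N)) (hadd N m hm n hn) 2
  rw [dist_eq_norm]
  refine lt_of_pow_lt_pow_left₀ 2 hε.le ?_
  linarith [(hN N le_rfl).2, (hN m hm).1, (hN n hn).1]

theorem exists_cauchySeq_mem_of_antitone_convex {C : ℕ → Set V} (hanti : Antitone C)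
    (hne : ∀ n, (C n).Nonempty) (hconv : ∀ n, Convex ℝ (C n)) {R : ℝ} (hR : ∀ u ∈ C 0, ‖u‖ ≤ R) :
    ∃ v : ℕ → V, (∀ n, v n ∈ C n) ∧ CauchySeq v := by
  let d : ℕ → ℝ := fun n => Metric.infDist 0 (C n)
  have hd_le {n : ℕ} {u : V} (hu : u ∈ C n) : d n ≤ ‖u‖ :=
    (Metric.infDist_le_dist_of_mem hu).trans_eq (dist_zero_left u)
  have hd_mono : Monotone d := fun m n hmn =>
    Metric.infDist_le_infDist_of_subset (hanti hmn) (hne n)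
  have hd_bdd : BddAbove (range d) := by
    refine ⟨R, forall_mem_range.2 fun n => ?_⟩
    obtain ⟨u, hu⟩ := hne n
    exact (hd_le hu).trans (hR u (hanti n.zero_le hu))
  have hd_lim : Tendsto d atTop (𝓝 (⨆ n, d n)) := tendsto_atTop_ciSup hd_mono hd_bdd
  have hnear (n : ℕ) : ∃ v ∈ C n, ‖v‖ ≤ d n + 1 / ((n : ℝ) + 1) := by
    obtain ⟨v, hv, hlt⟩ := (Metric.infDist_lt_iff (hne n)).1
      (lt_add_of_pos_right (d n) (Nat.one_div_pos_of_nat (n := n)))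
    exact ⟨v, hv, (dist_zero_left v ▸ hlt).le⟩
  choose v hvC hv using hnear
  have hv_lim : Tendsto (fun n => ‖v n‖) atTop (𝓝 (⨆ n, d n)) :=
    tendsto_of_tendsto_of_tendsto_of_le_of_le hd_lim
      (by simpa only [add_zero] using hd_lim.add tendsto_one_div_add_atTop_nhds_zero_nat)
      (fun n => hd_le (hvC n)) hv
  refine ⟨v, hvC, cauchySeq_of_tendsto_norm_of_le_norm_add hv_lim hd_lim
    (fun N => Metric.infDist_nonneg) fun N m hm n hn => ?_⟩
  have hmid := hd_le ((hconv N).midpoint_mem (hanti hm (hvC m)) (hanti hn (hvC n)))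
  rw [midpoint_eq_smul_add, norm_smul, invOf_eq_inv, norm_inv, Real.norm_ofNat] at hmid
  linarith

end ConvexCombinations

section WeakConvergence

variable {X : Type*} [MetricSpace X] [MeasurableSpace X] [BorelSpace X]

theorem measurable_toMeasure_of_continuous {α : Type*} [TopologicalSpace α] [MeasurableSpace α]
    [OpensMeasurableSpace α] {μ : α → ProbabilityMeasure X} (hμ : Continuous μ) :
    Measurable fun a => (μ a : Measure X) := by
  refine Measurable.measure_of_isPiSystem_of_isProbabilityMeasure
    (BorelSpace.measurable_eq.trans borel_eq_generateFrom_isClosed) isPiSystem_isClosed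
    fun C hC => UpperSemicontinuous.measurable (upperSemicontinuous_iff_limsup_le.2 fun a => ?_)
  exact ProbabilityMeasure.limsup_measure_closed_le_of_tendsto hμ.continuousAt hC

theorem measurable_integral_probabilityMeasure (f : C(X, ℝ)) :
    Measurable fun μ : ProbabilityMeasure X => ∫ x, f x ∂(μ : Measure X) :=
  (f.continuous.stronglyMeasurable.integral_kernel
    (κ := ⟨ProbabilityMeasure.toMeasure, measurable_subtype_coe⟩)).measurable

variable [CompactSpace X]

theorem continuous_integral_continuousMap (μ : Measure X) [IsFiniteMeasure μ] :
    Continuous fun f : C(X, ℝ) => ∫ x, f x ∂μ := by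
  have hint (f : C(X, ℝ)) : Integrable f μ :=
    f.continuous.integrable_of_hasCompactSupport (HasCompactSupport.of_compactSpace f)
  refine (LipschitzWith.of_dist_le' (K := μ.real univ) fun f g => ?_).continuous
  rw [Real.dist_eq, ← integral_sub (hint f) (hint g), dist_eq_norm, mul_comm]
  exact norm_integral_le_of_norm_le_const (ae_of_all μ (f - g).norm_coe_le_norm)

variable (X) in
theorem exists_isClosedEmbedding_integral :
    ∃ F : ℕ → C(X, ℝ), (∀ j, ‖F j‖ ≤ 1) ∧
      IsClosedEmbedding fun (μ : ProbabilityMeasure X) (j : ℕ) => ∫ x, F j x ∂(μ : Measure X) := by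
  let G : ℕ → C(X, ℝ) := TopologicalSpace.denseSeq C(X, ℝ)
  have hpos (j : ℕ) : 0 < 1 + ‖G j‖ := by positivity
  refine ⟨fun j => (1 + ‖G j‖)⁻¹ • G j, fun j => ?_, Continuous.isClosedEmbedding ?_ ?_⟩
  · rw [norm_smul, norm_inv, Real.norm_of_nonneg (hpos j).le, inv_mul_le_one₀ (hpos j)]
    exact le_add_of_nonneg_left zero_le_one
  · exact continuous_pi fun j => continuous_iff_continuousAt.2 fun μ =>
      ProbabilityMeasure.tendsto_iff_forall_integral_tendsto.1 tendsto_id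
        (BoundedContinuousFunction.mkOfCompact ((1 + ‖G j‖)⁻¹ • G j))
  · intro μ ν hμν
    have hG (j : ℕ) : ∫ x, G j x ∂(μ : Measure X) = ∫ x, G j x ∂(ν : Measure X) := by
      have hj := congrFun hμν j
      simp only [ContinuousMap.coe_smul, Pi.smul_apply, integral_smul] at hj
      exact smul_right_injective ℝ (inv_ne_zero (hpos j).ne') hj
    have hC := (TopologicalSpace.denseRange_denseSeq C(X, ℝ)).equalizer
      (continuous_integral_continuousMap (μ : Measure X))
      (continuous_integral_continuousMap (ν : Measure X)) (funext hG)
    have hμν' : (μ : Measure X) = (ν : Measure X) :=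
      ext_of_forall_integral_eq_of_IsFiniteMeasure fun f => congrFun hC f.toContinuousMap
    exact Subtype.ext hμν'

instance borelSpace_probabilityMeasure : BorelSpace (ProbabilityMeasure X) := by
  refine ⟨le_antisymm ?_ ?_⟩
  · exact measurable_iff_comap_le.1
      (@measurable_toMeasure_of_continuous X _ _ _ _ _ (borel _)
        (@OpensMeasurableSpace.mk _ _ (borel _) le_rfl) id continuous_id)
  · obtain ⟨F, -, hF⟩ := exists_isClosedEmbedding_integral X
    rw [hF.isInducing.eq_induced, borel_comap, ← BorelSpace.measurable_eq]
    exact (measurable_pi_iff.2 fun j => measurable_integral_probabilityMeasure (F j)).comap_le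

end WeakConvergence

section RandomMeasures

variable {Ω X : Type*} [MeasurableSpace Ω] [MeasurableSpace X]

/-- The kernel `ω ↦ a κ_ω + b η_ω`, used to form convex combinations of random measures. -/
noncomputable def kernelCombination (a b : ℝ≥0) (κ η : Kernel Ω X) : Kernel Ω X where
  toFun ω := a • κ ω + b • η ω
  measurable' := Measure.measurable_of_measurable_coe _ fun _ hs =>
    ((κ.measurable_coe hs).const_smul a).add ((η.measurable_coe hs).const_smul b)

theorem kernelCombination_apply (a b : ℝ≥0) (κ η : Kernel Ω X) (ω : Ω) :
    kernelCombination a b κ η ω = a • κ ω + b • η ω := rfl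

theorem isMarkovKernel_kernelCombination {a b : ℝ≥0} (hab : a + b = 1) (κ η : Kernel Ω X)
    [IsMarkovKernel κ] [IsMarkovKernel η] : IsMarkovKernel (kernelCombination a b κ η) := by
  refine ⟨fun ω => ⟨?_⟩⟩
  rw [kernelCombination_apply, Measure.add_apply, Measure.smul_apply, Measure.smul_apply,
    measure_univ, measure_univ, ← add_smul, hab, one_smul]

theorem compProd_kernelCombination (P : Measure Ω) [SFinite P] {a b : ℝ≥0} (hab : a + b = 1)
    (κ η : Kernel Ω X) [IsMarkovKernel κ] [IsMarkovKernel η] :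
    P ⊗ₘ kernelCombination a b κ η = a • (P ⊗ₘ κ) + b • (P ⊗ₘ η) := by
  have := isMarkovKernel_kernelCombination hab κ η
  ext s hs
  have hκ : Measurable fun ω => κ ω (Prod.mk ω ⁻¹' s) := Kernel.measurable_kernel_prodMk_left hs
  have hη : Measurable fun ω => η ω (Prod.mk ω ⁻¹' s) := Kernel.measurable_kernel_prodMk_left hs
  simp only [Measure.compProd_apply hs, kernelCombination_apply, Measure.add_apply,
    Measure.smul_apply, ENNReal.smul_def, smul_eq_mul]
  rw [lintegral_add_left (hκ.const_mul _), lintegral_const_mul _ hκ, lintegral_const_mul _ hη]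

/-- The values of a Markov kernel as points of the space of probability measures. -/
def kernelProbabilityMeasure (κ : Kernel Ω X) [IsMarkovKernel κ] (ω : Ω) : ProbabilityMeasure X :=
  ⟨κ ω, inferInstance⟩

variable [TopologicalSpace X]

/-- Weak convergence of the random measures `κs n ω` to `κ ω` for almost every `ω`. -/
def TendstoAEWeakly [OpensMeasurableSpace X] (P : Measure Ω) (κs : ℕ → Kernel Ω X)
    (κ : Kernel Ω X) [∀ n, IsMarkovKernel (κs n)] [IsMarkovKernel κ] : Prop :=
  ∀ᵐ ω ∂P, Tendsto (fun n => kernelProbabilityMeasure (κs n) ω) atTop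
    (𝓝 (kernelProbabilityMeasure κ ω))

/-- The integrals `∫ F_j dκ_ω` of a sequence of test functions, as one function on `Ω × ℕ`. -/
noncomputable def testIntegral (F : ℕ → C(X, ℝ)) (κ : Kernel Ω X) (p : Ω × ℕ) : ℝ :=
  ∫ x, F p.2 x ∂κ p.1

theorem norm_testIntegral_le {F : ℕ → C(X, ℝ)} (hF : ∀ j x, ‖F j x‖ ≤ 1) (κ : Kernel Ω X)
    [IsMarkovKernel κ] (p : Ω × ℕ) : ‖testIntegral F κ p‖ ≤ 1 := by
  simpa only [testIntegral, probReal_univ, mul_one] using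
    norm_integral_le_of_norm_le_const (ae_of_all (κ p.1) (hF p.2))

end RandomMeasures

section RandomMeasureCompactness

variable {Ω X : Type*} [MeasurableSpace Ω] [MetricSpace X] [MeasurableSpace X]
  [BorelSpace X]

theorem measurable_testIntegral (F : ℕ → C(X, ℝ)) (κ : Kernel Ω X) :
    Measurable (testIntegral F κ) :=
  measurable_from_prod_countable_left fun j =>
    ((F j).continuous.stronglyMeasurable.integral_kernel (κ := κ)).measurable

variable [CompactSpace X]

theorem testIntegral_kernelCombination (F : ℕ → C(X, ℝ)) (a b : ℝ≥0) (κ η : Kernel Ω X)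
    [IsFiniteKernel κ] [IsFiniteKernel η] (p : Ω × ℕ) :
    testIntegral F (kernelCombination a b κ η) p
      = a * testIntegral F κ p + b * testIntegral F η p := by
  have hint (μ : Measure X) [IsFiniteMeasure μ] : Integrable (F p.2) μ :=
    (F p.2).continuous.integrable_of_hasCompactSupport (HasCompactSupport.of_compactSpace _)
  rw [testIntegral, kernelCombination_apply, integral_add_measure (hint _) (hint _),
    integral_smul_nnreal_measure, integral_smul_nnreal_measure]
  rfl

theorem exists_tendstoAEWeakly_of_tendsto_testIntegral (P : Measure Ω) {F : ℕ → C(X, ℝ)}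
    (hF : IsClosedEmbedding
      fun (μ : ProbabilityMeasure X) (j : ℕ) => ∫ x, F j x ∂(μ : Measure X))
    (κs : ℕ → Kernel Ω X) [∀ n, IsMarkovKernel (κs n)]
    (hlim : ∀ᵐ ω ∂P, ∀ j, ∃ c, Tendsto (fun n => testIntegral F (κs n) (ω, j)) atTop (𝓝 c)) :
    ∃ (κ : Kernel Ω X) (_ : IsMarkovKernel κ), TendstoAEWeakly P κs κ := by
  have hκs (n : ℕ) : Measurable (kernelProbabilityMeasure (κs n)) :=
    (κs n).measurable.subtype_mk
  have hconv : ∀ᵐ ω ∂P, ∃ μ, Tendsto (fun n => kernelProbabilityMeasure (κs n) ω) atTop (𝓝 μ) := by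
    filter_upwards [hlim] with ω hω
    choose c hc using hω
    obtain ⟨μ, rfl⟩ : c ∈ range fun (μ : ProbabilityMeasure X) j => ∫ x, F j x ∂(μ : Measure X) :=
      hF.isClosed_range.mem_of_tendsto (tendsto_pi_nhds.2 hc)
        (Eventually.of_forall fun n => ⟨kernelProbabilityMeasure (κs n) ω, rfl⟩)
    exact ⟨μ, hF.isInducing.tendsto_nhds_iff.2 (tendsto_pi_nhds.2 hc)⟩
  obtain ⟨μ, hμ, hμlim⟩ := measurable_limit_of_tendsto_metrizable_ae
    (fun n => (hκs n).aemeasurable) hconv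
  let κ : Kernel Ω X := ⟨fun ω => μ ω, measurable_subtype_coe.comp hμ⟩
  have hκ : IsMarkovKernel κ := ⟨fun ω => (μ ω).2⟩
  exact ⟨κ, hκ, hμlim⟩

/-- The test integrals of the measures in `M n` form a bounded convex subset of an `L²` space, and
elements of nearly minimal norm converge strongly; this replaces weak compactness. -/
theorem exists_ae_tendsto_testIntegral_of_antitone_convex (P : Measure Ω) [IsProbabilityMeasure P]
    {F : ℕ → C(X, ℝ)} (hF : ∀ j x, ‖F j x‖ ≤ 1) {M : ℕ → Set (Measure (Ω × X))}
    (hanti : Antitone M) (hconv : ∀ n, Convex ℝ≥0 (M n))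
    (hne : ∀ n, ∃ (κ : Kernel Ω X) (_ : IsMarkovKernel κ), P ⊗ₘ κ ∈ M n) :
    ∃ (κs : ℕ → Kernel Ω X) (_ : ∀ n, IsMarkovKernel (κs n)), (∀ n, P ⊗ₘ κs n ∈ M n) ∧
      ∀ᵐ ω ∂P, ∀ j, ∃ c, Tendsto (fun n => testIntegral F (κs n) (ω, j)) atTop (𝓝 c) := by
  let w : Measure ℕ := (Measure.count : Measure ℕ).toFinite
  let C : ℕ → Set (Lp ℝ 2 (P.prod w)) := fun n => {v | ∃ (κ : Kernel Ω X) (_ : IsMarkovKernel κ),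
    P ⊗ₘ κ ∈ M n ∧ v =ᵐ[P.prod w] testIntegral F κ}
  have hC_ne (n : ℕ) : (C n).Nonempty := by
    obtain ⟨κ, hκ, hκM⟩ := hne n
    have hL : MemLp (testIntegral F κ) 2 (P.prod w) := MemLp.of_bound
      (measurable_testIntegral F κ).aestronglyMeasurable 1 (ae_of_all _ (norm_testIntegral_le hF κ))
    exact ⟨hL.toLp, κ, hκ, hκM, hL.coeFn_toLp⟩
  have hC_conv (n : ℕ) : Convex ℝ (C n) := by
    rintro u ⟨κ, hκ, hκM, hu⟩ v ⟨η, hη, hηM, hv⟩ a b ha hb hab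
    lift a to ℝ≥0 using ha
    lift b to ℝ≥0 using hb
    have hab' : a + b = 1 := by exact_mod_cast hab
    refine ⟨kernelCombination a b κ η, isMarkovKernel_kernelCombination hab' κ η, ?_, ?_⟩
    · rw [compProd_kernelCombination P hab']
      exact hconv n hκM hηM a.2 b.2 hab'
    · filter_upwards [hu, hv, Lp.coeFn_add ((a : ℝ) • u) ((b : ℝ) • v),
        Lp.coeFn_smul (a : ℝ) u, Lp.coeFn_smul (b : ℝ) v] with p hup hvp hadd hau hbv
      rw [hadd, Pi.add_apply, hau, hbv, Pi.smul_apply, Pi.smul_apply, hup, hvp,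
        testIntegral_kernelCombination, smul_eq_mul, smul_eq_mul]
  have hC_norm (v : Lp ℝ 2 (P.prod w)) (hv : v ∈ C 0) :
      ‖v‖ ≤ measureUnivNNReal (P.prod w) ^ (2 : ℝ≥0∞).toReal⁻¹ * 1 := by
    obtain ⟨κ, hκ, -, hvκ⟩ := hv
    exact Lp.norm_le_of_ae_bound zero_le_one
      (hvκ.mono fun p hp => hp ▸ norm_testIntegral_le hF κ p)
  obtain ⟨v, hvC, hv⟩ := exists_cauchySeq_mem_of_antitone_convex
    (C := C) (fun m n hmn v ⟨κ, hκ, hκM, hvκ⟩ => ⟨κ, hκ, hanti hmn hκM, hvκ⟩) hC_ne hC_conv hC_norm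
  obtain ⟨l, hl⟩ := cauchySeq_tendsto_of_complete hv
  obtain ⟨φ, hφ, hlim⟩ := (tendstoInMeasure_of_tendsto_Lp hl).exists_seq_tendsto_ae
  choose κs hκs hκM hvκ using hvC
  refine ⟨fun n => κs (φ n), fun n => hκs (φ n), fun n => hanti hφ.le_apply (hκM (φ n)), ?_⟩
  have hprod : ∀ᵐ p ∂P.prod w, Tendsto (fun n => testIntegral F (κs (φ n)) p) atTop (𝓝 (l p)) := by
    filter_upwards [hlim, ae_all_iff.2 hvκ] with p hp hvp
    exact hp.congr fun n => hvp (φ n)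
  filter_upwards [Measure.ae_ae_of_ae_prod hprod] with ω hω j
  rw [ae_toFinite] at hω
  exact ⟨_, Measure.ae_count_iff.1 hω j⟩

theorem exists_tendstoAEWeakly_of_antitone_convex (P : Measure Ω) [IsProbabilityMeasure P]
    {M : ℕ → Set (Measure (Ω × X))} (hanti : Antitone M) (hconv : ∀ n, Convex ℝ≥0 (M n))
    (hne : ∀ n, ∃ (κ : Kernel Ω X) (_ : IsMarkovKernel κ), P ⊗ₘ κ ∈ M n) :
    ∃ (κs : ℕ → Kernel Ω X) (κ : Kernel Ω X) (_ : ∀ n, IsMarkovKernel (κs n))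
      (_ : IsMarkovKernel κ), (∀ n, P ⊗ₘ κs n ∈ M n) ∧ TendstoAEWeakly P κs κ := by
  obtain ⟨F, hF_le, hF⟩ := exists_isClosedEmbedding_integral X
  obtain ⟨κs, hκs, hκsM, hlim⟩ := exists_ae_tendsto_testIntegral_of_antitone_convex P
    (fun j x => ((F j).norm_coe_le_norm x).trans (hF_le j)) hanti hconv hne
  obtain ⟨κ, hκ, hκlim⟩ := exists_tendstoAEWeakly_of_tendsto_testIntegral P hF κs hlim
  exact ⟨κs, κ, hκs, hκ, hκsM, hκlim⟩

end RandomMeasureCompactness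

section AlmostInvariance

variable {α β : Type*} [MeasurableSpace α] [MeasurableSpace β] {Θ : α → α}

/-- `μ` and its push-forward under `Θ` differ by measures of mass at most `δ`; the two error terms
stand on opposite sides to avoid subtracting measures. -/
def AlmostInvariant (Θ : α → α) (δ : ℝ≥0∞) (μ : Measure α) : Prop :=
  ∃ ρ ρ' : Measure α, ρ univ ≤ δ ∧ ρ' univ ≤ δ ∧ μ.map Θ + ρ = μ + ρ'

theorem AlmostInvariant.mono {δ δ' : ℝ≥0∞} {μ : Measure α} (h : AlmostInvariant Θ δ μ)
    (hδ : δ ≤ δ') : AlmostInvariant Θ δ' μ :=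
  let ⟨ρ, ρ', hρ, hρ', heq⟩ := h
  ⟨ρ, ρ', hρ.trans hδ, hρ'.trans hδ, heq⟩

theorem convex_setOf_almostInvariant (hΘ : Measurable Θ) (δ : ℝ≥0∞) :
    Convex ℝ≥0 {μ | AlmostInvariant Θ δ μ} := by
  rintro μ ⟨ρ, ρ', hρ, hρ', hμ⟩ ν ⟨σ, σ', hσ, hσ', hν⟩ a b - - hab
  have hle {τ υ : Measure α} (hτ : τ univ ≤ δ) (hυ : υ univ ≤ δ) :
      (a • τ + b • υ) univ ≤ δ :=
    calc (a • τ + b • υ) univ = a • τ univ + b • υ univ := rfl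
      _ ≤ a • δ + b • δ := by gcongr
      _ = δ := by rw [← add_smul, hab, one_smul]
  refine ⟨a • ρ + b • σ, a • ρ' + b • σ', hle hρ hσ, hle hρ' hσ', ?_⟩
  rw [Measure.map_add _ _ hΘ, Measure.map_smul, Measure.map_smul, add_add_add_comm, ← smul_add,
    ← smul_add, hμ, hν, smul_add, smul_add, add_add_add_comm]

/-- The average `(1/k) ∑_{i<k} Θ^i ν` of the push-forwards of `ν`, as in the Krylov–Bogoliubov
construction. -/
noncomputable def orbitAverage (Θ : α → α) (ν : Measure α) (k : ℕ) : Measure α :=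
  (k : ℝ≥0∞)⁻¹ • ∑ i ∈ Finset.range k, ν.map Θ^[i]

theorem almostInvariant_orbitAverage (hΘ : Measurable Θ) (ν : Measure α) [IsProbabilityMeasure ν]
    (k : ℕ) : AlmostInvariant Θ (k : ℝ≥0∞)⁻¹ (orbitAverage Θ ν k) := by
  have hmap : (∑ i ∈ Finset.range k, ν.map Θ^[i]).map Θ
      = ∑ i ∈ Finset.range k, ν.map Θ^[i + 1] := by
    rw [← Measure.mapₗ_apply_of_measurable hΘ, map_sum]
    refine Finset.sum_congr rfl fun i _ => ?_
    rw [Measure.mapₗ_apply_of_measurable hΘ, Measure.map_map hΘ (hΘ.iterate i),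
      Function.iterate_succ']
  have : IsProbabilityMeasure (ν.map Θ^[k]) :=
    Measure.isProbabilityMeasure_map (hΘ.iterate k).aemeasurable
  refine ⟨(k : ℝ≥0∞)⁻¹ • ν, (k : ℝ≥0∞)⁻¹ • ν.map Θ^[k], ?_, ?_, ?_⟩
  · rw [Measure.smul_apply, measure_univ, smul_eq_mul, mul_one]
  · rw [Measure.smul_apply, measure_univ, smul_eq_mul, mul_one]
  · have hsum := Finset.sum_range_succ' (fun i => ν.map Θ^[i]) k
    rw [Finset.sum_range_succ, Function.iterate_zero, Measure.map_id] at hsum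
    rw [orbitAverage, Measure.map_smul, hmap, ← smul_add, ← smul_add, hsum]

theorem orbitAverage_apply (hΘ : Measurable Θ) (ν : Measure α) (k : ℕ) {B : Set α}
    (hB : MeasurableSet B) :
    orbitAverage Θ ν k B = (k : ℝ≥0∞)⁻¹ * ∑ i ∈ Finset.range k, ν (Θ^[i] ⁻¹' B) := by
  rw [orbitAverage, Measure.smul_apply, Measure.finsetSum_apply, smul_eq_mul]
  congr 1
  exact Finset.sum_congr rfl fun i _ => Measure.map_apply (hΘ.iterate i) hB

theorem orbitAverage_compl_eq_zero (hΘ : Measurable Θ) {ν : Measure α} {S : Set α}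
    (hS : MeasurableSet S) (hmaps : MapsTo Θ S S) (hν : ν Sᶜ = 0) (k : ℕ) :
    orbitAverage Θ ν k Sᶜ = 0 := by
  have hzero (i : ℕ) : ν (Θ^[i] ⁻¹' Sᶜ) = 0 :=
    measure_mono_null (fun p hp hpS => hp (hmaps.iterate i hpS)) hν
  simp only [orbitAverage_apply hΘ ν k hS.compl, hzero, Finset.sum_const_zero, mul_zero]

theorem map_orbitAverage {ϑ : β → β} {π : α → β} (hπ : Measurable π)
    (hsemi : Function.Semiconj π Θ ϑ) (hΘ : Measurable Θ) {ν : Measure α}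
    (hϑ : MeasurePreserving ϑ (ν.map π) (ν.map π)) {k : ℕ} (hk : k ≠ 0) :
    (orbitAverage Θ ν k).map π = ν.map π := by
  have hmap (i : ℕ) : (ν.map Θ^[i]).map π = ν.map π := by
    rw [Measure.map_map hπ (hΘ.iterate i), (hsemi.iterate_right i).comp_eq,
      ← Measure.map_map (hϑ.measurable.iterate i) hπ, (hϑ.iterate i).map_eq]
  rw [orbitAverage, Measure.map_smul, ← Measure.mapₗ_apply_of_measurable hπ, map_sum]
  simp only [Measure.mapₗ_apply_of_measurable hπ, hmap, Finset.sum_const, Finset.card_range]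
  rw [← Nat.cast_smul_eq_nsmul ℝ≥0∞, smul_smul,
    ENNReal.inv_mul_cancel (Nat.cast_ne_zero.2 hk) (ENNReal.natCast_ne_top k), one_smul]

theorem orbitAverage_eq_self {μ : Measure α} (hΘ : MeasurePreserving Θ μ μ) {k : ℕ} (hk : k ≠ 0) :
    orbitAverage Θ μ k = μ := by
  simp only [orbitAverage, (hΘ.iterate _).map_eq, Finset.sum_const, Finset.card_range]
  rw [← Nat.cast_smul_eq_nsmul ℝ≥0∞, smul_smul,
    ENNReal.inv_mul_cancel (Nat.cast_ne_zero.2 hk) (ENNReal.natCast_ne_top k), one_smul]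

end AlmostInvariance

section VisitFrequency

variable {α : Type*} {Θ : α → α}

theorem birkhoffSum_indicator_nonneg (B : Set α) (n : ℕ) (p : α) :
    0 ≤ birkhoffSum Θ (B.indicator (1 : α → ℝ)) n p :=
  Finset.sum_nonneg fun _ _ => indicator_nonneg (fun _ _ => zero_le_one) _

theorem birkhoffSum_indicator_le (B : Set α) (n : ℕ) (p : α) :
    birkhoffSum Θ (B.indicator (1 : α → ℝ)) n p ≤ n :=
  calc birkhoffSum Θ (B.indicator (1 : α → ℝ)) n p
      ≤ ∑ _i ∈ Finset.range n, (1 : ℝ) :=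
        Finset.sum_le_sum fun i _ => indicator_le_self' (fun _ _ => zero_le_one) (Θ^[i] p)
    _ = n := by simp

variable [MeasurableSpace α]

theorem measurable_birkhoffSum (hΘ : Measurable Θ) {g : α → ℝ} (hg : Measurable g) (n : ℕ) :
    Measurable (birkhoffSum Θ g n) :=
  Finset.measurable_fun_sum _ fun i _ => hg.comp (hΘ.iterate i)

theorem measureReal_orbitAverage (hΘ : Measurable Θ) (ν : Measure α) [IsFiniteMeasure ν] (k : ℕ)
    {B : Set α} (hB : MeasurableSet B) :
    (orbitAverage Θ ν k).real B = ∫ p, birkhoffAverage ℝ Θ (B.indicator 1) k p ∂ν := by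
  have hpre (i : ℕ) : MeasurableSet (Θ^[i] ⁻¹' B) := (hΘ.iterate i) hB
  have hcomp (i : ℕ) (p : α) : B.indicator (1 : α → ℝ) (Θ^[i] p) = (Θ^[i] ⁻¹' B).indicator 1 p :=
    rfl
  simp only [birkhoffAverage, birkhoffSum, hcomp]
  rw [integral_smul, integral_finsetSum _ fun i _ => (integrable_const 1).indicator (hpre i),
    measureReal_def, orbitAverage_apply hΘ ν k hB, ENNReal.toReal_mul, ENNReal.toReal_inv,
    ENNReal.toReal_natCast, ENNReal.toReal_sum fun i _ => measure_ne_top ν _, smul_eq_mul]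
  simp only [integral_indicator_one (hpre _), measureReal_def]

theorem measure_eq_zero_of_ae_tendsto_birkhoffAverage {μ : Measure α} [IsFiniteMeasure μ]
    (hΘ : MeasurePreserving Θ μ μ) {B : Set α} (hB : MeasurableSet B)
    (hlim : ∀ᵐ p ∂μ,
      Tendsto (fun n => birkhoffAverage ℝ Θ (B.indicator (1 : α → ℝ)) n p) atTop (𝓝 0)) :
    μ B = 0 := by
  have hlim_integral : Tendsto (fun n => ∫ p, birkhoffAverage ℝ Θ (B.indicator 1) n p ∂μ) atTop
      (𝓝 (∫ _, (0 : ℝ) ∂μ)) := by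
    refine tendsto_integral_of_dominated_convergence (fun _ => 1) (fun n => ?_)
      (integrable_const _) (fun n => ae_of_all μ fun p => ?_) hlim
    · have hsum := measurable_birkhoffSum (g := B.indicator (1 : α → ℝ)) hΘ.measurable
        (measurable_one.indicator hB) n
      exact (hsum.const_mul (n : ℝ)⁻¹).aestronglyMeasurable
    · rw [birkhoffAverage, smul_eq_mul, Real.norm_of_nonneg (mul_nonneg (by positivity)
        (birkhoffSum_indicator_nonneg B n p)), inv_mul_eq_div]
      exact div_le_one_of_le₀ (birkhoffSum_indicator_le B n p) n.cast_nonneg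
  rw [integral_zero] at hlim_integral
  have hconst : ∀ᶠ n in atTop, ∫ p, birkhoffAverage ℝ Θ (B.indicator 1) n p ∂μ = μ.real B := by
    filter_upwards [eventually_ne_atTop 0] with n hn
    rw [← measureReal_orbitAverage hΘ.measurable μ n hB, orbitAverage_eq_self hΘ hn]
  exact (measureReal_eq_zero_iff).1
    (tendsto_nhds_unique (tendsto_const_nhds.congr' (hconst.mono fun _ h => h.symm)) hlim_integral)

end VisitFrequency

section RandomPortmanteau

variable {Ω X : Type*} [MeasurableSpace Ω] [MetricSpace X] [MeasurableSpace X] [BorelSpace X]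
  {P : Measure Ω} [IsProbabilityMeasure P]

theorem ext_of_forall_lintegral_caratheodory {ρ₁ ρ₂ : Measure (Ω × X)} [IsFiniteMeasure ρ₁]
    (h : ∀ F : Ω × X → ℝ≥0, Measurable F → (∃ c, ∀ p, F p ≤ c) →
      (∀ ω, Continuous fun x => F (ω, x)) → ∫⁻ p, F p ∂ρ₁ = ∫⁻ p, F p ∂ρ₂) :
    ρ₁ = ρ₂ := by
  refine Measure.ext_prod fun {A B} hA hB => ?_
  have hlintegral (ρ : Measure (Ω × X)) (f : X →ᵇ ℝ≥0) :
      ∫⁻ x, f x ∂((ρ.restrict (Prod.fst ⁻¹' A)).map Prod.snd)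
        = ∫⁻ p, ((Prod.fst ⁻¹' A).indicator (fun p => f p.2) p : ℝ≥0) ∂ρ := by
    rw [lintegral_map (by fun_prop) measurable_snd, ← lintegral_indicator (measurable_fst hA)]
    refine lintegral_congr fun p => ?_
    rw [ENNReal.coe_indicator]
  have hrect (ρ : Measure (Ω × X)) :
      (ρ.restrict (Prod.fst ⁻¹' A)).map Prod.snd B = ρ (A ×ˢ B) := by
    rw [Measure.map_apply measurable_snd hB, Measure.restrict_apply (measurable_snd hB),
      inter_comm, Set.prod_eq]
  suffices heq : (ρ₁.restrict (Prod.fst ⁻¹' A)).map Prod.snd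
      = (ρ₂.restrict (Prod.fst ⁻¹' A)).map Prod.snd by
    rw [← hrect, ← hrect, heq]
  refine ext_of_forall_lintegral_eq_of_IsFiniteMeasure fun f => ?_
  rw [hlintegral, hlintegral]
  refine h _ (Measurable.indicator (by fun_prop) (measurable_fst hA)) ⟨nndist f 0, fun p => ?_⟩
    fun ω => ?_
  · exact indicator_le' (fun p _ => BoundedContinuousFunction.NNReal.upper_bound f p.2)
      (fun _ _ => zero_le) p
  · by_cases hω : ω ∈ A
    · exact f.continuous.congr fun x =>
        (indicator_of_mem (s := Prod.fst ⁻¹' A) (a := (ω, x)) hω fun p => f p.2).symm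
    · exact continuous_const.congr fun x =>
        (indicator_of_notMem (s := Prod.fst ⁻¹' A) (a := (ω, x)) hω fun p => f p.2).symm

variable {κs : ℕ → Kernel Ω X} {κ : Kernel Ω X} [∀ n, IsMarkovKernel (κs n)] [IsMarkovKernel κ]

theorem le_compProd_of_tendstoAEWeakly (hlim : TendstoAEWeakly P κs κ) {C : Set (Ω × X)}
    (hC : MeasurableSet C) (hclosed : ∀ ω, IsClosed (bundleFiber C ω)) {c : ℝ≥0∞}
    (hc : ∀ n, c ≤ (P ⊗ₘ κs n) C) : c ≤ (P ⊗ₘ κ) C :=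
  calc c ≤ limsup (fun n => (P ⊗ₘ κs n) C) atTop :=
        le_limsup_of_frequently_le (Frequently.of_forall hc)
    _ = limsup (fun n => ∫⁻ ω, κs n ω (bundleFiber C ω) ∂P) atTop := by
        simp only [Measure.compProd_apply hC]; rfl
    _ ≤ ∫⁻ ω, limsup (fun n => κs n ω (bundleFiber C ω)) atTop ∂P :=
        limsup_lintegral_le (fun _ => 1) (fun n => Kernel.measurable_kernel_prodMk_left hC)
          (fun n => ae_of_all P fun ω => prob_le_one) (by simp)
    _ ≤ ∫⁻ ω, κ ω (bundleFiber C ω) ∂P :=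
        lintegral_mono_ae (hlim.mono fun ω hω =>
          ProbabilityMeasure.limsup_measure_closed_le_of_tendsto hω (hclosed ω))
    _ = (P ⊗ₘ κ) C := (Measure.compProd_apply hC).symm

theorem compProd_compl_eq_zero_of_tendstoAEWeakly (hlim : TendstoAEWeakly P κs κ)
    {S : Set (Ω × X)} (hS : MeasurableSet S) (hclosed : ∀ ω, IsClosed (bundleFiber S ω))
    (hsupp : ∀ n, (P ⊗ₘ κs n) Sᶜ = 0) : (P ⊗ₘ κ) Sᶜ = 0 :=
  (prob_compl_eq_zero_iff hS).2 <| le_antisymm prob_le_one <|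
    le_compProd_of_tendstoAEWeakly hlim hS hclosed fun n =>
      ((prob_compl_eq_zero_iff hS).1 (hsupp n)).ge

variable [CompactSpace X]

theorem tendsto_lintegral_of_continuousOn {μs : ℕ → ProbabilityMeasure X}
    {μ : ProbabilityMeasure X} (h : Tendsto μs atTop (𝓝 μ)) {C : Set X} (hC : IsClosed C)
    (hμs : ∀ n, (μs n : Measure X) Cᶜ = 0) (hμ : (μ : Measure X) Cᶜ = 0) {f : X → ℝ≥0}
    (hf : ContinuousOn f C) :
    Tendsto (fun n => ∫⁻ x, f x ∂(μs n : Measure X)) atTop (𝓝 (∫⁻ x, f x ∂(μ : Measure X))) := by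
  obtain ⟨g, hg⟩ := ContinuousMap.exists_restrict_eq hC
    (⟨C.domRestrict f, hf.domRestrict⟩ : C(C, ℝ≥0))
  have hcongr (ν : Measure X) (hν : ν Cᶜ = 0) : ∫⁻ x, g x ∂ν = ∫⁻ x, f x ∂ν := by
    refine lintegral_congr_ae ?_
    filter_upwards [measure_eq_zero_iff_ae_notMem.1 hν] with x hx
    exact congrArg _ (congrArg (fun F : C(C, ℝ≥0) => F ⟨x, not_not.1 hx⟩) hg)
  rw [← hcongr _ hμ]
  exact (ProbabilityMeasure.tendsto_iff_forall_lintegral_tendsto.1 h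
    (BoundedContinuousFunction.mkOfCompact g)).congr fun n => hcongr _ (hμs n)

theorem tendsto_lintegral_compProd (hlim : TendstoAEWeakly P κs κ) {S : Set (Ω × X)}
    (hS : MeasurableSet S) (hclosed : ∀ ω, IsClosed (bundleFiber S ω))
    (hsupp : ∀ n, (P ⊗ₘ κs n) Sᶜ = 0) {F : Ω × X → ℝ≥0} (hF : Measurable F)
    (hbdd : ∃ c, ∀ p, F p ≤ c)
    (hcont : ∀ᵐ ω ∂P, ContinuousOn (fun x => F (ω, x)) (bundleFiber S ω)) :
    Tendsto (fun n => ∫⁻ p, F p ∂(P ⊗ₘ κs n)) atTop (𝓝 (∫⁻ p, F p ∂(P ⊗ₘ κ))) := by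
  have hfiber (η : Kernel Ω X) [IsMarkovKernel η] (hη : (P ⊗ₘ η) Sᶜ = 0) :
      ∀ᵐ ω ∂P, η ω (bundleFiber S ω)ᶜ = 0 :=
    Measure.ae_ae_of_ae_compProd (measure_eq_zero_iff_ae_notMem.1 hη) |>.mono fun ω hω =>
      measure_eq_zero_iff_ae_notMem.2 hω
  obtain ⟨c, hc⟩ := hbdd
  have hF' : Measurable fun p => (F p : ℝ≥0∞) := hF.coe_nnreal_ennreal
  simp only [Measure.lintegral_compProd hF']
  refine tendsto_lintegral_of_dominated_convergence (fun _ => (c : ℝ≥0∞))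
    (fun n => hF'.lintegral_kernel_prod_right') (fun n => ae_of_all P fun ω => ?_) (by simp) ?_
  · exact (lintegral_mono fun x => ENNReal.coe_le_coe.2 (hc (ω, x))).trans (by simp)
  · filter_upwards [hlim, hcont, ae_all_iff.2 fun n => hfiber (κs n) (hsupp n),
      hfiber κ (compProd_compl_eq_zero_of_tendstoAEWeakly hlim hS hclosed hsupp)]
      with ω hω hcontω hsuppω hlimω
    exact tendsto_lintegral_of_continuousOn hω (hclosed ω) hsuppω hlimω hcontω

end RandomPortmanteau

section InvariantLimit

variable {Ω X : Type*} [MeasurableSpace Ω] [MeasurableSpace X] {P : Measure Ω}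
  {Θ : Ω × X → Ω × X} {S : Set (Ω × X)} {E : Set X} {ε δ : ℝ≥0∞}

/-- The measures with marginal `P` that are carried by `S`, invariant under `Θ` up to `δ`, and
charge `Ω × E` with mass at least `ε`. -/
structure IsAlmostInvariantRandomMeasure (P : Measure Ω) (Θ : Ω × X → Ω × X) (S : Set (Ω × X))
    (E : Set X) (ε δ : ℝ≥0∞) (μ : Measure (Ω × X)) : Prop where
  fst_eq : μ.fst = P
  compl_eq_zero : μ Sᶜ = 0
  le_measure : ε ≤ μ (univ ×ˢ E)
  almostInvariant : AlmostInvariant Θ δ μ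

theorem convex_setOf_isAlmostInvariantRandomMeasure (hΘ : Measurable Θ) :
    Convex ℝ≥0 {μ | IsAlmostInvariantRandomMeasure P Θ S E ε δ μ} := by
  intro μ hμ ν hν a b ha hb hab
  refine ⟨?_, ?_, ?_, convex_setOf_almostInvariant hΘ δ hμ.almostInvariant hν.almostInvariant
    ha hb hab⟩
  · rw [Measure.fst, Measure.map_add _ _ measurable_fst, Measure.map_smul, Measure.map_smul]
    change a • μ.fst + b • ν.fst = P
    rw [hμ.fst_eq, hν.fst_eq, ← add_smul, hab, one_smul]
  · rw [Measure.add_apply, Measure.smul_apply, Measure.smul_apply, hμ.compl_eq_zero,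
      hν.compl_eq_zero, smul_zero, smul_zero, add_zero]
  · calc ε = a • ε + b • ε := by rw [← add_smul, hab, one_smul]
      _ ≤ a • μ (univ ×ˢ E) + b • ν (univ ×ˢ E) := by
        gcongr
        exacts [hμ.le_measure, hν.le_measure]
      _ = (a • μ + b • ν) (univ ×ˢ E) := rfl

theorem isAlmostInvariantRandomMeasure_orbitAverage [IsProbabilityMeasure P] {ϑ : Ω → Ω}
    (hϑ : MeasurePreserving ϑ P P) (hΘ : Measurable Θ)
    (hsemi : Function.Semiconj Prod.fst Θ ϑ) (hS : MeasurableSet S) (hmaps : MapsTo Θ S S)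
    {ν : Measure (Ω × X)} (hν : ν.fst = P) (hνS : ν Sᶜ = 0) {k : ℕ} (hk : k ≠ 0)
    (hε : ε ≤ orbitAverage Θ ν k (univ ×ˢ E)) :
    IsAlmostInvariantRandomMeasure P Θ S E ε (k : ℝ≥0∞)⁻¹ (orbitAverage Θ ν k) := by
  subst hν
  have : IsProbabilityMeasure ν := ⟨by rw [← Measure.fst_univ, measure_univ]⟩
  exact ⟨map_orbitAverage measurable_fst hsemi hΘ hϑ hk,
    orbitAverage_compl_eq_zero hΘ hS hmaps hνS k, hε, almostInvariant_orbitAverage hΘ ν k⟩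

theorem IsAlmostInvariantRandomMeasure.mono {δ' : ℝ≥0∞} {μ : Measure (Ω × X)}
    (hμ : IsAlmostInvariantRandomMeasure P Θ S E ε δ μ) (hδ : δ ≤ δ') :
    IsAlmostInvariantRandomMeasure P Θ S E ε δ' μ :=
  ⟨hμ.fst_eq, hμ.compl_eq_zero, hμ.le_measure, hμ.almostInvariant.mono hδ⟩

theorem tendsto_lintegral_zero_of_measure_univ_le {α : Type*} [MeasurableSpace α] {F : α → ℝ≥0}
    {c : ℝ≥0} (hc : ∀ p, F p ≤ c) {ρ : ℕ → Measure α} {δ : ℕ → ℝ≥0∞}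
    (hδ : Tendsto δ atTop (𝓝 0)) (hρ : ∀ n, ρ n univ ≤ δ n) :
    Tendsto (fun n => ∫⁻ p, F p ∂ρ n) atTop (𝓝 0) := by
  have hlim : Tendsto (fun n => (c : ℝ≥0∞) * δ n) atTop (𝓝 0) := by
    simpa only [mul_zero] using ENNReal.Tendsto.const_mul hδ (Or.inr ENNReal.coe_ne_top)
  refine tendsto_of_tendsto_of_tendsto_of_le_of_le tendsto_const_nhds hlim
    (fun _ => zero_le) fun n => ?_
  calc ∫⁻ p, F p ∂ρ n ≤ ∫⁻ _, c ∂ρ n := lintegral_mono fun p => ENNReal.coe_le_coe.2 (hc p)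
    _ = c * ρ n univ := lintegral_const _
    _ ≤ c * δ n := by gcongr; exact hρ n

theorem exists_isMarkovKernel_compProd_eq [StandardBorelSpace X] [IsProbabilityMeasure P]
    {μ : Measure (Ω × X)} (hμ : μ.fst = P) :
    ∃ (κ : Kernel Ω X) (_ : IsMarkovKernel κ), P ⊗ₘ κ = μ := by
  subst hμ
  have : IsProbabilityMeasure μ := ⟨by rw [← Measure.fst_univ, measure_univ]⟩
  have : Nonempty X := (nonempty_of_isProbabilityMeasure μ).map Prod.snd
  exact ⟨μ.condKernel, inferInstance, μ.disintegrate μ.condKernel⟩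

variable [MetricSpace X] [BorelSpace X] [CompactSpace X] [IsProbabilityMeasure P]

theorem measurePreserving_compProd_of_almostInvariant {κs : ℕ → Kernel Ω X} {κ : Kernel Ω X}
    [∀ n, IsMarkovKernel (κs n)] [IsMarkovKernel κ] (hlim : TendstoAEWeakly P κs κ)
    {ϑ : Ω → Ω} (hsemi : Function.Semiconj Prod.fst Θ ϑ) (hΘ : Measurable Θ)
    (hS : MeasurableSet S) (hclosed : ∀ ω, IsClosed (bundleFiber S ω))
    (hcont : ∀ᵐ ω ∂P, ContinuousOn (fun x => (Θ (ω, x)).2) (bundleFiber S ω))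
    (hsupp : ∀ n, (P ⊗ₘ κs n) Sᶜ = 0) {δ : ℕ → ℝ≥0∞} (hδ : Tendsto δ atTop (𝓝 0))
    (hinv : ∀ n, AlmostInvariant Θ (δ n) (P ⊗ₘ κs n)) :
    MeasurePreserving Θ (P ⊗ₘ κ) (P ⊗ₘ κ) := by
  have : IsProbabilityMeasure ((P ⊗ₘ κ).map Θ) := Measure.isProbabilityMeasure_map hΘ.aemeasurable
  refine ⟨hΘ, ext_of_forall_lintegral_caratheodory fun F hF ⟨c, hc⟩ hFcont => ?_⟩
  have hF' : Measurable fun p => (F p : ℝ≥0∞) := hF.coe_nnreal_ennreal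
  choose ρ ρ' hρ hρ' heq using hinv
  have hΘlim := tendsto_lintegral_compProd hlim hS hclosed hsupp (hF.comp hΘ)
    ⟨c, fun p => hc (Θ p)⟩ <| hcont.mono fun ω hω =>
      ((hFcont (ϑ ω)).comp_continuousOn hω).congr fun x _ =>
        congrArg F (Prod.ext (hsemi (ω, x)) rfl)
  have hFlim := tendsto_lintegral_compProd hlim hS hclosed hsupp hF ⟨c, hc⟩
    (ae_of_all P fun ω => (hFcont ω).continuousOn)
  have hleft := hΘlim.add (tendsto_lintegral_zero_of_measure_univ_le hc hδ hρ)
  have hright := hFlim.add (tendsto_lintegral_zero_of_measure_univ_le hc hδ hρ')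
  rw [add_zero] at hleft hright
  rw [lintegral_map hF' hΘ]
  refine tendsto_nhds_unique (hleft.congr fun n => ?_) hright
  rw [← lintegral_add_measure, ← heq n, lintegral_add_measure, lintegral_map hF' hΘ]
  rfl

theorem exists_measurePreserving_of_orbitAverage_ge {ϑ : Ω → Ω} (hϑ : MeasurePreserving ϑ P P)
    (hsemi : Function.Semiconj Prod.fst Θ ϑ) (hΘ : Measurable Θ)
    (hS : MeasurableSet S) (hclosed : ∀ ω, IsClosed (bundleFiber S ω)) (hmaps : MapsTo Θ S S)
    (hcont : ∀ᵐ ω ∂P, ContinuousOn (fun x => (Θ (ω, x)).2) (bundleFiber S ω))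
    (hE : IsClosed E) (hvisits : ∀ n : ℕ, ∃ ν : Measure (Ω × X), ν.fst = P ∧ ν Sᶜ = 0 ∧
      ε ≤ orbitAverage Θ ν (n + 1) (univ ×ˢ E)) :
    ∃ μ : Measure (Ω × X), μ.fst = P ∧ μ Sᶜ = 0 ∧ MeasurePreserving Θ μ μ ∧
      ε ≤ μ (univ ×ˢ E) := by
  let δ (n : ℕ) : ℝ≥0∞ := ((n + 1 : ℕ) : ℝ≥0∞)⁻¹
  have hδ_anti : Antitone δ := fun m n hmn =>
    ENNReal.inv_le_inv.2 (Nat.cast_le.2 (Nat.succ_le_succ hmn))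
  have hδ : Tendsto δ atTop (𝓝 0) :=
    (tendsto_add_atTop_iff_nat 1).2 ENNReal.tendsto_inv_nat_nhds_zero
  obtain ⟨κs, κ, _, _, hκs, hlim⟩ := exists_tendstoAEWeakly_of_antitone_convex P
    (M := fun n => {μ | IsAlmostInvariantRandomMeasure P Θ S E ε (δ n) μ})
    (fun m n hmn μ hμ => hμ.mono (hδ_anti hmn))
    (fun n => convex_setOf_isAlmostInvariantRandomMeasure hΘ) fun n => by
      obtain ⟨ν, hν, hνS, hε⟩ := hvisits n
      have hmem := isAlmostInvariantRandomMeasure_orbitAverage hϑ hΘ hsemi hS hmaps hν hνS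
        n.succ_ne_zero hε
      obtain ⟨κ, hκ, hκν⟩ := exists_isMarkovKernel_compProd_eq hmem.fst_eq
      exact ⟨κ, hκ, hκν ▸ hmem⟩
  have hsupp (n : ℕ) : (P ⊗ₘ κs n) Sᶜ = 0 := (hκs n).compl_eq_zero
  refine ⟨P ⊗ₘ κ, Measure.fst_compProd P κ,
    compProd_compl_eq_zero_of_tendstoAEWeakly hlim hS hclosed hsupp,
    measurePreserving_compProd_of_almostInvariant hlim hsemi hΘ hS hclosed hcont hsupp hδ
      fun n => (hκs n).almostInvariant,
    le_compProd_of_tendstoAEWeakly hlim (MeasurableSet.univ.prod hE.measurableSet)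
      (fun ω => by simpa [bundleFiber] using hE) fun n => (hκs n).le_measure⟩

end InvariantLimit

theorem measurePreserving_iff_of_measurableEmbedding {α β : Type*} [MeasurableSpace α]
    [MeasurableSpace β] {μ : Measure α} {ν : Measure β} {e : α → β} (he : MeasurableEmbedding e)
    (heμ : MeasurePreserving e μ ν) {f : α → α} {g : β → β} (hsemi : Function.Semiconj e f g)
    (hf : Measurable f) (hg : Measurable g) :
    MeasurePreserving f μ μ ↔ MeasurePreserving g ν ν := by
  refine ⟨fun h => heμ.of_semiconj h hsemi hg, fun h => ⟨hf, ?_⟩⟩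
  rw [← he.comap_map (μ.map f), Measure.map_map he.measurable hf, hsemi.comp_eq,
    (h.comp heμ).map_eq, ← heμ.map_eq, he.comap_map]

namespace BundleRDS

section

variable {Ω : Type*} [MeasurableSpace Ω] {P : Measure Ω} {ϑ : Ω → Ω}
  {X : Type*} [MetricSpace X] [MeasurableSpace X] (T : BundleRDS P ϑ X)

theorem isRandomCompactSet_bundle : IsRandomCompactSet T.bundle :=
  ⟨T.measurableSet_bundle, T.nonempty_fiber, T.isCompact_fiber⟩

open Classical in
/-- The fiber maps, extended by the identity off the bundle. -/
noncomputable def extendedMap (p : Ω × X) : X :=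
  if h : p ∈ T.bundle then T.map p.1 ⟨p.2, h⟩ else p.2

/-- The skew product, extended to the whole product space so that it can act on measures
on `Ω × X`. -/
noncomputable def extendedSkew (p : Ω × X) : Ω × X := (ϑ p.1, T.extendedMap p)

theorem semiconj_fst_extendedSkew : Function.Semiconj Prod.fst T.extendedSkew ϑ := fun _ => rfl

theorem extendedMap_coe (p : T.bundle) : T.extendedMap p = T.map p.1.1 ⟨p.1.2, p.2⟩ :=
  dif_pos p.2

theorem semiconj_coe_skewProduct :
    Function.Semiconj ((↑) : T.bundle → Ω × X) T.skewProduct T.extendedSkew := fun p =>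
  Prod.ext rfl (T.extendedMap_coe p).symm

theorem mapsTo_extendedSkew : MapsTo T.extendedSkew T.bundle T.bundle := fun p hp => by
  rw [← T.semiconj_coe_skewProduct ⟨p, hp⟩]
  exact Subtype.property _

theorem extendedSkew_iterate_coe (n : ℕ) (p : T.bundle) :
    T.extendedSkew^[n] p = (ϑ^[n] p.1.1, (T.iter n p.1.1 ⟨p.1.2, p.2⟩ : X)) :=
  (T.semiconj_coe_skewProduct.iterate_right n p).symm.trans (T.skewProduct_iterate n p)

theorem measurable_extendedMap : Measurable T.extendedMap := by
  refine measurable_of_restrict_of_restrict_compl T.measurableSet_bundle ?_ ?_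
  · rw [show T.bundle.domRestrict T.extendedMap = fun p => ↑(T.map p.1.1 ⟨p.1.2, p.2⟩) from
      funext T.extendedMap_coe]
    exact T.measurable_map
  · rw [show T.bundleᶜ.domRestrict T.extendedMap = fun p => p.1.2 from funext fun p => dif_neg p.2]
    exact measurable_snd.comp measurable_subtype_coe

theorem measurable_extendedSkew (hϑ : Measurable ϑ) : Measurable T.extendedSkew :=
  (hϑ.comp measurable_fst).prodMk T.measurable_extendedMap

theorem measurable_skewProduct (hϑ : Measurable ϑ) : Measurable T.skewProduct :=
  ((hϑ.comp (measurable_fst.comp measurable_subtype_coe)).prodMk T.measurable_map).subtype_mk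

theorem continuousOn_extendedMap {ω : Ω} (h : Continuous (T.map ω)) :
    ContinuousOn (fun x => T.extendedMap (ω, x)) (bundleFiber T.bundle ω) := by
  rw [continuousOn_iff_continuous_domRestrict]
  exact (continuous_subtype_val.comp h).congr fun x => (T.extendedMap_coe ⟨(ω, x), x.2⟩).symm

theorem ae_continuous_iter (hϑ : MeasurePreserving ϑ P P) :
    ∀ᵐ ω ∂P, ∀ n, Continuous (T.iter n ω) := by
  have horbit : ∀ᵐ ω ∂P, ∀ i, Continuous (T.map (ϑ^[i] ω)) := ae_all_iff.2 fun i =>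
    (hϑ.iterate i).quasiMeasurePreserving.ae T.continuous_map
  filter_upwards [horbit] with ω hω n
  induction n generalizing ω with
  | zero => exact continuous_id
  | succ n ih => exact (ih (ϑ ω) fun i => hω (i + 1)).comp (hω 0)

theorem isInvariantRandomMeasure_iff (hϑ : Measurable ϑ) {μ : Measure (Ω × X)} :
    T.IsInvariantRandomMeasure μ ↔ IsProbabilityMeasure μ ∧ μ.fst = P ∧ μ T.bundleᶜ = 0 ∧
      MeasurePreserving T.extendedSkew μ μ := by
  have hinv (hμ : μ T.bundleᶜ = 0) : MeasurePreserving T.skewProduct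
      (μ.comap (Subtype.val : T.bundle → Ω × X)) (μ.comap Subtype.val) ↔
        MeasurePreserving T.extendedSkew μ μ := by
    have hcoe := measurePreserving_subtype_coe (μa := μ) T.measurableSet_bundle
    rw [Measure.restrict_eq_self_of_ae_mem (mem_ae_iff.2 hμ)] at hcoe
    exact measurePreserving_iff_of_measurableEmbedding (.subtype_coe T.measurableSet_bundle) hcoe
      T.semiconj_coe_skewProduct (T.measurable_skewProduct hϑ) (T.measurable_extendedSkew hϑ)
  constructor
  · rintro ⟨hprob, hfst, hone, hskew⟩
    have hcompl := (prob_compl_eq_zero_iff T.measurableSet_bundle).2 hone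
    exact ⟨hprob, hfst, hcompl, (hinv hcompl).1 hskew⟩
  · rintro ⟨hprob, hfst, hcompl, hskew⟩
    exact ⟨hprob, hfst, (prob_compl_eq_zero_iff T.measurableSet_bundle).1 hcompl,
      (hinv hcompl).2 hskew⟩

/-- The number of visits to `Ω × E` of the first `n` points of the orbit of `p` under the extended
skew product. -/
noncomputable def visits (E : Set X) (n : ℕ) (p : Ω × X) : ℝ :=
  birkhoffSum T.extendedSkew ((univ ×ˢ E).indicator 1) n p

variable {E : Set X}

theorem visits_coe (n : ℕ) {ω : Ω} (x : bundleFiber T.bundle ω) :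
    T.visits E n (ω, x)
      = ∑ i ∈ Finset.range n, E.indicator (fun _ => (1 : ℝ)) (T.iter i ω x : X) := by
  unfold visits birkhoffSum
  refine Finset.sum_congr rfl fun i _ => ?_
  rw [T.extendedSkew_iterate_coe i ⟨(ω, x), x.2⟩]
  rw [univ_prod]
  rfl

theorem maxVisits_eq_ciSup_visits (n : ℕ) (ω : Ω) :
    T.maxVisits E n ω = ⨆ x : bundleFiber T.bundle ω, T.visits E n (ω, x) := by
  simp only [maxVisits, visits_coe]

theorem measurable_visits (hϑ : Measurable ϑ) (hE : MeasurableSet E) (n : ℕ) :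
    Measurable (T.visits E n) :=
  measurable_birkhoffSum (T.measurable_extendedSkew hϑ)
    (measurable_one.indicator (MeasurableSet.univ.prod hE)) n

theorem bddAbove_visits (n : ℕ) (ω : Ω) :
    BddAbove (range fun x : bundleFiber T.bundle ω => T.visits E n (ω, x)) :=
  ⟨n, forall_mem_range.2 fun _ => birkhoffSum_indicator_le _ n _⟩

theorem visits_le_maxVisits (n : ℕ) {ω : Ω} (x : bundleFiber T.bundle ω) :
    T.visits E n (ω, x) ≤ T.maxVisits E n ω := by
  rw [maxVisits_eq_ciSup_visits]
  exact le_ciSup (T.bddAbove_visits n ω) x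

theorem maxVisits_nonneg (n : ℕ) (ω : Ω) : 0 ≤ T.maxVisits E n ω := by
  obtain ⟨x, hx⟩ := T.nonempty_fiber ω
  exact (birkhoffSum_indicator_nonneg _ n _).trans (T.visits_le_maxVisits n ⟨x, hx⟩)

theorem maxVisits_le (n : ℕ) (ω : Ω) : T.maxVisits E n ω ≤ n := by
  have := (T.nonempty_fiber ω).to_subtype
  rw [maxVisits_eq_ciSup_visits]
  exact ciSup_le fun x => birkhoffSum_indicator_le _ n _

theorem isSubadditiveCocycle_maxVisits : IsSubadditiveCocycle ϑ (T.maxVisits E) := by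
  intro m n ω
  have := (T.nonempty_fiber ω).to_subtype
  rw [T.maxVisits_eq_ciSup_visits (m + n)]
  refine ciSup_le fun x => ?_
  rw [visits, birkhoffSum_add, T.extendedSkew_iterate_coe m ⟨(ω, x), x.2⟩]
  exact add_le_add (T.visits_le_maxVisits m x) (T.visits_le_maxVisits n (T.iter m ω x))

theorem upperSemicontinuousOn_visits (hE : IsClosed E) {ω : Ω} (h : ∀ n, Continuous (T.iter n ω))
    (n : ℕ) : UpperSemicontinuousOn (fun x => T.visits E n (ω, x)) (bundleFiber T.bundle ω) := by
  rw [← upperSemicontinuousOn_iff_restrict]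
  have hvisits : (bundleFiber T.bundle ω).domRestrict (fun x => T.visits E n (ω, x)) = fun x =>
      ∑ i ∈ Finset.range n, E.indicator (fun _ => (1 : ℝ)) (T.iter i ω x : X) :=
    funext (T.visits_coe n)
  rw [hvisits]
  exact upperSemicontinuous_sum fun i _ =>
    (hE.upperSemicontinuous_indicator zero_le_one).comp (continuous_subtype_val.comp (h i))

theorem measure_eq_zero_of_isSmall (hϑ : Measurable ϑ) (hE : MeasurableSet E) (hsmall : T.IsSmall E)
    {μ : Measure (Ω × X)} (hμ : T.IsInvariantRandomMeasure μ) : μ (univ ×ˢ E) = 0 := by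
  obtain ⟨_, rfl, hcompl, hinv⟩ := (T.isInvariantRandomMeasure_iff hϑ).1 hμ
  refine measure_eq_zero_of_ae_tendsto_birkhoffAverage hinv (MeasurableSet.univ.prod hE) ?_
  filter_upwards [ae_of_ae_map measurable_fst.aemeasurable hsmall, mem_ae_iff.2 hcompl]
    with p hcapacity hp
  refine squeeze_zero (fun n => mul_nonneg (by positivity) (birkhoffSum_indicator_nonneg _ n p))
    (fun n => ?_) hcapacity
  rw [birkhoffAverage, smul_eq_mul, one_div]
  exact mul_le_mul_of_nonneg_left (T.visits_le_maxVisits n ⟨p.2, hp⟩) (by positivity)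

variable [IsProbabilityMeasure P] [P.IsComplete] [CompactSpace X] [BorelSpace X]

theorem measurable_maxVisits (hϑ : Measurable ϑ) (hE : MeasurableSet E) (n : ℕ) :
    Measurable (T.maxVisits E n) := by
  rw [funext (T.maxVisits_eq_ciSup_visits n)]
  exact measurable_ciSup_fiber P T.measurableSet_bundle T.nonempty_fiber
    (T.measurable_visits hϑ hE n) (T.bddAbove_visits n)

theorem exists_measureReal_orbitAverage_eq (hϑ : MeasurePreserving ϑ P P) (hE : IsClosed E)
    (n : ℕ) :
    ∃ ν : Measure (Ω × X), ν.fst = P ∧ ν T.bundleᶜ = 0 ∧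
      (orbitAverage T.extendedSkew ν n).real (univ ×ˢ E)
        = (n : ℝ)⁻¹ * ∫ ω, T.maxVisits E n ω ∂P := by
  have hvisits := T.measurable_visits hϑ.measurable hE.measurableSet n
  obtain ⟨s, hs, hsT, hmax⟩ := T.isRandomCompactSet_bundle.exists_measurable_section_eq_iSup P
    hvisits ((T.ae_continuous_iter hϑ).mono fun ω hω => T.upperSemicontinuousOn_visits hE hω n)
  have hgraph : Measurable fun ω => (ω, s ω) := measurable_id.prodMk hs
  have := Measure.isProbabilityMeasure_map (μ := P) hgraph.aemeasurable
  refine ⟨P.map fun ω => (ω, s ω), ?_, ?_, ?_⟩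
  · rw [Measure.fst_map_prodMk hs, Measure.map_id']
  · rw [Measure.map_apply hgraph T.measurableSet_bundle.compl]
    exact measure_mono_null (fun ω hω => hω (hsT ω)) measure_empty
  · rw [measureReal_orbitAverage (T.measurable_extendedSkew hϑ.measurable) _ n
      (MeasurableSet.univ.prod hE.measurableSet)]
    calc ∫ p, (n : ℝ)⁻¹ * T.visits E n p ∂P.map (fun ω => (ω, s ω))
        = (n : ℝ)⁻¹ * ∫ ω, T.visits E n (ω, s ω) ∂P := by
          rw [integral_const_mul,
            integral_map hgraph.aemeasurable hvisits.aestronglyMeasurable]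
      _ = (n : ℝ)⁻¹ * ∫ ω, T.maxVisits E n ω ∂P := by
          rw [funext (T.maxVisits_eq_ciSup_visits n), integral_congr_ae hmax]

theorem exists_isInvariantRandomMeasure (hϑ : MeasurePreserving ϑ P P) (hE : IsClosed E) {ε : ℝ}
    (hε : ∀ k : ℕ, 0 < k → ε * k ≤ ∫ ω, T.maxVisits E k ω ∂P) :
    ∃ μ : Measure (Ω × X), T.IsInvariantRandomMeasure μ ∧ ENNReal.ofReal ε ≤ μ (univ ×ˢ E) := by
  obtain ⟨μ, hfst, hcompl, hinv, hle⟩ := exists_measurePreserving_of_orbitAverage_ge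
    (ε := ENNReal.ofReal ε) hϑ T.semiconj_fst_extendedSkew
    (T.measurable_extendedSkew hϑ.measurable) T.measurableSet_bundle
    (fun ω => (T.isCompact_fiber ω).isClosed) T.mapsTo_extendedSkew
    (T.continuous_map.mono fun ω => T.continuousOn_extendedMap) hE fun n => by
      obtain ⟨ν, hν, hνT, heq⟩ := T.exists_measureReal_orbitAverage_eq hϑ hE (n + 1)
      refine ⟨ν, hν, hνT, ENNReal.ofReal_le_of_le_toReal ?_⟩
      rw [← measureReal_def, heq, inv_mul_eq_div, le_div_iff₀ (Nat.cast_pos.2 n.succ_pos)]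
      exact hε (n + 1) n.succ_pos
  have : IsProbabilityMeasure μ := ⟨by rw [← Measure.fst_univ, hfst, measure_univ]⟩
  exact ⟨μ, (T.isInvariantRandomMeasure_iff hϑ.measurable).2 ⟨this, hfst, hcompl, hinv⟩, hle⟩

end

end BundleRDS

theorem mainTheorem6 {Ω : Type*} [MeasurableSpace Ω] (P : Measure Ω) [IsProbabilityMeasure P]
    [P.IsComplete] (ϑ : Ω → Ω) (hϑ : MeasurePreserving ϑ P P)
    {X : Type*} [MetricSpace X] [CompactSpace X] [MeasurableSpace X] [BorelSpace X]
    (T : BundleRDS P ϑ X) (E : Set X) (hE : IsClosed E) :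
    T.IsSmall E ↔
      ∀ μ : Measure (Ω × X), T.IsInvariantRandomMeasure μ → μ (Set.univ ×ˢ E) = 0 := by
  refine ⟨fun hsmall μ hμ =>
    T.measure_eq_zero_of_isSmall hϑ.measurable hE.measurableSet hsmall hμ, fun hnull => ?_⟩
  refine T.isSubadditiveCocycle_maxVisits.ae_tendsto_zero hϑ
    (fun n => (T.measurable_maxVisits hϑ.measurable hE.measurableSet n).aestronglyMeasurable)
    T.maxVisits_nonneg zero_le_one (fun n ω => (T.maxVisits_le n ω).trans_eq (one_mul _).symm)
    fun ε hε => ?_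
  by_contra! hlarge
  obtain ⟨μ, hμ, hle⟩ := T.exists_isInvariantRandomMeasure hϑ hE hlarge
  rw [hnull μ hμ] at hle
  exact (ENNReal.ofReal_pos.2 hε).not_ge hle
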